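/- Let $Y=[-\tfrac12,\tfrac12)^2$ and let $D$ be a bounded connected open set with $C^2$ boundary and closure contained in the interior of $Y$, such that the complement $Y^*$ of $D$ in $Y$ is connected. Let $\varepsilon_i\in\mathbb C$ with $\operatorname{Im}\varepsilon_i>0$ and $\operatorname{Re}\varepsilon_i>0$, let $\varepsilon_e>0$ and $k_0>0$. Let $H^1_{\sharp,0}(Y^*)$ be the space of restrictions to $Y^*$ of $Y$-periodic functions in $H^1_{loc}(\mathbb R^2)$ whose mean value over $Y^*$ is zero. Then there are constants $C_1,C_2>0$, depending only on $D$, $Y^*$, $\varepsilon_i$, $\varepsilon_e$ and $k_0$, such that the following holds for all $k\ge k_0$, all bounded domains $\Omega\subset\subset G\subset\mathbb R^2$ with $\partial\Omega$ of class $C^2$ and $G$ convex with polygonal boundary, and all $g\in L^2(\partial G)$ (in particular all $g\in H^{1/2}(\partial G)$). If $(u,u_1,u_2)\in H^1(G)\times L^2(\Omega;H^1_{\sharp,0}(Y^*))\times L^2(\Omega;H^1_0(D))$ is a solution of the two-scale equation, that is, \[ \begin{aligned} &\int_\Omega\int_{Y^*}\varepsilon_e^{-1}(\nabla u+\nabla_yu_1)\cdot(\nabla\psi^*+\nabla_y\psi_1^*)\,dy\,dx+\int_\Omega\int_D\varepsilon_i^{-1}\nabla_yu_2\cdot\nabla_y\psi_2^*\,dy\,dx\\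 &\quad-k^2\int_G\int_Y(u+\chi_Du_2)(\psi^*+\chi_D\psi_2^*)\,dy\,dx+\int_{G\setminus\overline\Omega}\nabla u\cdot\nabla\psi^*\,dx-ik\int_{\partial G}u\,\psi^*\,d\sigma=\int_{\partial G}g\,\psi^*\,d\sigma \end{aligned} \] for all $(\psi,\psi_1,\psi_2)$ in the same space (where $^*$ on functions is complex conjugation, and $u_2,\psi_2$ are extended by zero to $x\in G\setminus\Omega$), then the correctors $u_1$ and $u_2$ satisfy \[ \|u_1\|_{L^2(\Omega;H^1(Y^*))}\le C_1\|\nabla u\|_{L^2(G)}\qquad\text{and}\qquad \|u_2\|_{L^2(\Omega;1,k,D)}\le C_2\|u\|_{1,k,G}. \] Here $\|u\|_{1,k,G}^2=\|\nabla u\|_{L^2(G)}^2+k^2\|u\|_{L^2(G)}^2$ and $\|u_2\|_{L^2(\Omega;1,k,D)}^2=\|\nabla_yu_2\|_{L^2(\Omega;L^2(D))}^2+k^2\|u_2\|_{L^2(\Omega;L^2(D))}^2$. -/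

import Mathlib

open MeasureTheory Set Filter Topology
open scoped ContDiff ENNReal ComplexConjugate

noncomputable section

namespace TwoScale

/-! ### The plane, the unit cell, regularity of domains -/

/-- The Euclidean plane. -/
abbrev Plane : Type := EuclideanSpace ℝ (Fin 2)

/-- Complex vectors with two components, with the Hermitian norm (values of gradients). -/
abbrev CVec : Type := EuclideanSpace ℂ (Fin 2)

/-- The `j`-th unit vector of the plane. -/
def unitVec (j : Fin 2) : Plane := EuclideanSpace.single j 1

/-- The product `a · b*`: the real (bilinear) scalar product of `a` and the conjugate of `b`. -/
def dotConj (a b : CVec) : ℂ := ∑ j, a j * conj (b j)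

/-- The unit cell `Y = [-1/2, 1/2)²`. -/
def cell : Set Plane := {y | ∀ j, y j ∈ Ico (-1 / 2 : ℝ) (1 / 2)}

/-- The interior `(-1/2, 1/2)²` of the unit cell. -/
def openCell : Set Plane := {y | ∀ j, y j ∈ Ioo (-1 / 2 : ℝ) (1 / 2)}

/-- The complement `Y*` of `D` in the unit cell, as an open set. For `D` with `C²` boundary it
differs from `Y \ D` by a set of measure zero only. -/
def YStar (D : Set Plane) : Set Plane := openCell \ closure D

/-- The boundary of `U` is of class `C²`: near each boundary point, and in suitable Cartesian
coordinates, `U` is the region strictly above the graph of a `C²` function. -/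
def HasC2Boundary (U : Set Plane) : Prop :=
  ∀ x ∈ frontier U, ∃ (e : Plane ≃ᵃⁱ[ℝ] Plane) (γ : ℝ → ℝ) (r : ℝ), ContDiff ℝ 2 γ ∧ 0 < r ∧
    ∀ y ∈ Metric.ball x r, y ∈ U ↔ γ (e y 0) < e y 1

/-- Bounded domains with `C²` boundary. -/
structure IsC2Domain (U : Set Plane) : Prop where
  isOpen : IsOpen U
  isConnected : IsConnected U
  isBounded : Bornology.IsBounded U
  boundary : HasC2Boundary U

/-- Bounded convex domains with polygonal (hence Lipschitz) boundary: non-empty interiors of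
convex hulls of finitely many points. -/
def IsConvexPolygon (G : Set Plane) : Prop :=
  G.Nonempty ∧ ∃ S : Finset Plane, G = interior (convexHull ℝ (S : Set Plane))

/-- The inclusion: a domain `D ⊂⊂ Y` with `C²` boundary whose complement `Y*` in the
cell is connected. -/
structure IsInclusion (D : Set Plane) : Prop where
  isC2Domain : IsC2Domain D
  closure_subset : closure D ⊆ openCell
  isConnected_YStar : IsConnected (YStar D)

/-! ### Sobolev spaces -/

/-- `v` is square integrable on the compact subsets of `s`. -/
def MemL2loc {F : Type*} [NormedAddCommGroup F] (s : Set Plane) (v : Plane → F) : Prop :=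
  ∀ K : Set Plane, IsCompact K → K ⊆ s → MemLp v 2 (volume.restrict K)

/-- `p` is the weak gradient of `v` on `s`. -/
def HasWeakGrad (s : Set Plane) (v : Plane → ℂ) (p : Plane → CVec) : Prop :=
  ∀ φ : Plane → ℝ, ContDiff ℝ ∞ φ → HasCompactSupport φ → tsupport φ ⊆ s → ∀ j : Fin 2,
    ∫ x in s, fderiv ℝ φ x (unitVec j) • v x = -∫ x in s, φ x • p x j

theorem integrable_smul_of_memL2loc {s : Set Plane} {f : Plane → ℝ} {v : Plane → ℂ}
    (hf : Continuous f) {K : Set Plane} (hK : IsCompact K) (hKs : K ⊆ s)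
    (hfK : Function.support f ⊆ K) (hv : MemL2loc s v) :
    Integrable (fun x => f x • v x) (volume.restrict s) := by
  have h1 : IntegrableOn (fun x => f x • v x) K volume := by
    have : IsFiniteMeasure (volume.restrict K) := ⟨by simpa using hK.measure_lt_top⟩
    have hvK : IntegrableOn v K volume := (hv K hK hKs).integrable (by norm_num)
    exact hvK.continuousOn_smul hf.continuousOn hK
  have h2 : Integrable (fun x => f x • v x) volume := by
    refine (integrableOn_iff_integrable_of_support_subset ?_).1 h1
    intro x hx
    refine hfK ?_
    intro h0
    exact hx (by simp [h0])
  exact h2.mono_measure Measure.restrict_le_self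

theorem MemL2loc.coord {s : Set Plane} {p : Plane → CVec} (hp : MemL2loc s p) (j : Fin 2) :
    MemL2loc s (fun x => p x j) := fun K hK hKs =>
  (EuclideanSpace.proj (𝕜 := ℂ) j : CVec →L[ℂ] ℂ).comp_memLp' (hp K hK hKs)

theorem MemL2loc.add {F : Type*} [NormedAddCommGroup F] {s : Set Plane} {v w : Plane → F}
    (hv : MemL2loc s v) (hw : MemL2loc s w) : MemL2loc s (v + w) :=
  fun K hK hKs => (hv K hK hKs).add (hw K hK hKs)

theorem MemL2loc.const_smul {F : Type*} [NormedAddCommGroup F] [NormedSpace ℂ F]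
    {s : Set Plane} {v : Plane → F} (hv : MemL2loc s v) (c : ℂ) : MemL2loc s (c • v) :=
  fun K hK hKs => (hv K hK hKs).const_smul c

theorem MemL2loc.of_memLp {F : Type*} [NormedAddCommGroup F] {s : Set Plane} {v : Plane → F}
    (hv : MemLp v 2 (volume.restrict s)) : MemL2loc s v :=
  fun _ _ hKs => hv.mono_measure (Measure.restrict_mono hKs le_rfl)

theorem HasWeakGrad.zero (s : Set Plane) : HasWeakGrad s 0 0 := by
  intro φ _ _ _ j
  simp

theorem HasWeakGrad.add {s : Set Plane} {v w : Plane → ℂ} {p q : Plane → CVec}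
    (hv : MemL2loc s v) (hp : MemL2loc s p) (hw : MemL2loc s w) (hq : MemL2loc s q)
    (h1 : HasWeakGrad s v p) (h2 : HasWeakGrad s w q) : HasWeakGrad s (v + w) (p + q) := by
  intro φ hφ hc hs j
  have hd : Continuous fun x => fderiv ℝ φ x (unitVec j) :=
    (hφ.continuous_fderiv (by simp)).clm_apply continuous_const
  have hsd : Function.support (fun x => fderiv ℝ φ x (unitVec j)) ⊆ tsupport φ :=
    (subset_tsupport _).trans (tsupport_fderiv_apply_subset ℝ (unitVec j))
  have i1 := integrable_smul_of_memL2loc hd hc hs hsd hv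
  have i2 := integrable_smul_of_memL2loc hd hc hs hsd hw
  have i3 := integrable_smul_of_memL2loc hφ.continuous hc hs (subset_tsupport φ) (hp.coord j)
  have i4 := integrable_smul_of_memL2loc hφ.continuous hc hs (subset_tsupport φ) (hq.coord j)
  have e1 := h1 φ hφ hc hs j
  have e2 := h2 φ hφ hc hs j
  simp only [Pi.add_apply, PiLp.add_apply, smul_add]
  rw [integral_add i1 i2, integral_add i3 i4, e1, e2, neg_add]

theorem HasWeakGrad.const_smul {s : Set Plane} {v : Plane → ℂ} {p : Plane → CVec}
    (h : HasWeakGrad s v p) (c : ℂ) : HasWeakGrad s (c • v) (c • p) := by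
  intro φ hφ hc hs j
  have e := h φ hφ hc hs j
  simp only [Pi.smul_apply, PiLp.smul_apply]
  simp_rw [smul_comm _ c]
  rw [integral_smul, integral_smul, e, smul_neg]

theorem HasWeakGrad.congr_ae {s : Set Plane} {v w : Plane → ℂ} {p q : Plane → CVec}
    (h : HasWeakGrad s v p) (hv : w =ᵐ[volume.restrict s] v)
    (hp : q =ᵐ[volume.restrict s] p) : HasWeakGrad s w q := by
  intro φ hφ hc hs j
  rw [integral_congr_ae (g := fun x => fderiv ℝ φ x (unitVec j) • v x),
    integral_congr_ae (f := fun x => φ x • q x j) (g := fun x => φ x • p x j)]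
  · exact h φ hφ hc hs j
  · filter_upwards [hp] with x hx
    rw [hx]
  · filter_upwards [hv] with x hx
    rw [hx]

/-- `L²(s; ℂ) × L²(s; ℂ²)` with the Hilbert norm `(‖v‖² + ‖p‖²)^(1/2)`. -/
abbrev L2Pair (s : Set Plane) : Type :=
  WithLp 2 (Lp ℂ 2 (volume.restrict s) × Lp CVec 2 (volume.restrict s))

/-- The function `v` of a pair `(v, ∇v)`. -/
def toL2 {s : Set Plane} (v : L2Pair s) : Lp ℂ 2 (volume.restrict s) := v.fst

/-- The gradient `∇v` of a pair `(v, ∇v)`. -/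
def wgrad {s : Set Plane} (v : L2Pair s) : Lp CVec 2 (volume.restrict s) := v.snd

/-- The complex Sobolev space `H¹(s)` of an open set `s`, realised as the space of the pairs
`(v, ∇v)` with `v` and its weak gradient `∇v` square integrable. The induced norm is
`‖v‖_{H¹(s)} = (‖v‖² + ‖∇v‖²)^(1/2)`. -/
def H1 (s : Set Plane) : Submodule ℂ (L2Pair s) where
  carrier := {v | HasWeakGrad s v.fst v.snd}
  zero_mem' := (HasWeakGrad.zero s).congr_ae (Lp.coeFn_zero _ _ _) (Lp.coeFn_zero _ _ _)
  add_mem' := fun {v w} hv hw =>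
    (HasWeakGrad.add (.of_memLp (Lp.memLp v.fst)) (.of_memLp (Lp.memLp v.snd))
      (.of_memLp (Lp.memLp w.fst)) (.of_memLp (Lp.memLp w.snd)) hv hw).congr_ae
      (Lp.coeFn_add _ _) (Lp.coeFn_add _ _)
  smul_mem' := fun c _ hv =>
    (HasWeakGrad.const_smul hv c).congr_ae (Lp.coeFn_smul _ _) (Lp.coeFn_smul _ _)

/-- The elements of `H¹(s)` given by `C^∞` functions with compact support in `s`. -/
def testSpace (s : Set Plane) : Submodule ℂ (L2Pair s) where
  carrier := {v | v ∈ H1 s ∧ ∃ φ : Plane → ℂ, ContDiff ℝ ∞ φ ∧ HasCompactSupport φ ∧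
    tsupport φ ⊆ s ∧ toL2 v =ᵐ[volume.restrict s] φ}
  zero_mem' := ⟨(H1 s).zero_mem, 0, contDiff_const, HasCompactSupport.zero,
    by simp [tsupport], Lp.coeFn_zero _ _ _⟩
  add_mem' := by
    rintro v w ⟨h0, φ, h1, h2, h3, h4⟩ ⟨k0, χ, k1, k2, k3, k4⟩
    refine ⟨(H1 s).add_mem h0 k0, φ + χ, h1.add k1, h2.add k2,
      (tsupport_add φ χ).trans (union_subset h3 k3), ?_⟩
    exact (Lp.coeFn_add (toL2 v) (toL2 w)).trans (h4.add k4)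
  smul_mem' := by
    rintro c v ⟨h0, φ, h1, h2, h3, h4⟩
    refine ⟨(H1 s).smul_mem c h0, c • φ, contDiff_const.smul h1, ?_, ?_, ?_⟩
    · exact h2.smul_left (f := fun _ => c)
    · exact (tsupport_smul_subset_right (fun _ => c) φ).trans h3
    · exact (Lp.coeFn_smul c (toL2 v)).trans (h4.const_smul c)

/-- `H¹₀(s)`: the closure, in the norm of `H¹(s)`, of the `C^∞` functions with compact support
in `s`. -/
def H10 (s : Set Plane) : Submodule ℂ (L2Pair s) := (testSpace s).topologicalClosure

/-- `V` is `Y`-periodic. -/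
def IsPeriodic (V : Plane → ℂ) : Prop := ∀ j : Fin 2, ∀ᵐ y, V (y + unitVec j) = V y

/-- `V` belongs to `H¹_loc(ℝ²)`. -/
def MemH1loc (V : Plane → ℂ) : Prop :=
  MemL2loc univ V ∧ ∃ P : Plane → CVec, MemL2loc univ P ∧ HasWeakGrad univ V P

/-- The space of the restrictions to `Y*` of `Y`-periodic functions in `H¹_loc(ℝ²)`, normalised
by mean value zero over `Y*`; a subspace of `H¹(Y*)`, with its norm. -/
def H1PerZero (D : Set Plane) : Submodule ℂ (L2Pair (YStar D)) where
  carrier := {v | v ∈ H1 (YStar D) ∧ (∃ V : Plane → ℂ, MemH1loc V ∧ IsPeriodic V ∧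
      toL2 v =ᵐ[volume.restrict (YStar D)] V) ∧ ∫ y in YStar D, toL2 v y = 0}
  zero_mem' := by
    have h0 : (toL2 (0 : L2Pair (YStar D))) =ᵐ[volume.restrict (YStar D)] (0 : Plane → ℂ) :=
      Lp.coeFn_zero _ _ _
    refine ⟨(H1 _).zero_mem, ⟨0, ⟨fun _ _ _ => MemLp.zero, 0, fun _ _ _ => MemLp.zero, HasWeakGrad.zero _⟩,
      fun j => by simp, h0⟩, ?_⟩
    rw [integral_congr_ae h0]
    simp
  add_mem' := by
    rintro v w ⟨hv1, ⟨V, ⟨hV, P, hP, hVP⟩, hVper, hvV⟩, hv0⟩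
      ⟨hw1, ⟨W, ⟨hW, Q, hQ, hWQ⟩, hWper, hwW⟩, hw0⟩
    have hadd : toL2 (v + w) =ᵐ[volume.restrict (YStar D)] fun y => toL2 v y + toL2 w y :=
      Lp.coeFn_add (toL2 v) (toL2 w)
    refine ⟨(H1 _).add_mem hv1 hw1, ⟨V + W, ⟨hV.add hW, P + Q, hP.add hQ, HasWeakGrad.add hV hP hW hQ hVP hWQ⟩, ?_,
      hadd.trans (hvV.add hwW)⟩, ?_⟩
    · intro j
      filter_upwards [hVper j, hWper j] with y h1 h2
      simp [h1, h2]
    · have : IsFiniteMeasure (volume.restrict (YStar D)) := by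
        refine ⟨?_⟩
        rw [Measure.restrict_apply_univ]
        refine lt_of_le_of_lt (measure_mono (t := Metric.closedBall (0 : Plane) 1) ?_)
          measure_closedBall_lt_top
        intro y hy
        have h0 := hy.1 0
        have h1 := hy.1 1
        rw [mem_closedBall_zero_iff, EuclideanSpace.norm_eq, Real.sqrt_le_one]
        simp only [Fin.sum_univ_two, Real.norm_eq_abs, sq_abs]
        nlinarith [h0.1, h0.2, h1.1, h1.2]
      rw [integral_congr_ae hadd, integral_add, hv0, hw0, add_zero]
      · exact (Lp.memLp (toL2 v)).integrable (by norm_num)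
      · exact (Lp.memLp (toL2 w)).integrable (by norm_num)
  smul_mem' := by
    rintro c v ⟨hv1, ⟨V, ⟨hV, P, hP, hVP⟩, hVper, hvV⟩, hv0⟩
    have hsmul : toL2 (c • v) =ᵐ[volume.restrict (YStar D)] fun y => c • toL2 v y :=
      Lp.coeFn_smul c (toL2 v)
    refine ⟨(H1 _).smul_mem c hv1, ⟨c • V, ⟨hV.const_smul c, c • P, hP.const_smul c, hVP.const_smul c⟩, ?_,
      hsmul.trans (hvV.const_smul c)⟩, ?_⟩
    · intro j
      filter_upwards [hVper j] with y h1
      simp [h1]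
    · rw [integral_congr_ae hsmul, integral_smul, hv0, smul_zero]

/-! ### Traces -/

/-- Arc length on the boundary of `G`. -/
def bdry (G : Set Plane) : Measure Plane := (Measure.hausdorffMeasure 1).restrict (frontier G)

/-- `t` is the trace on `∂G` of `v ∈ H¹(G)`: the graph of the trace operator is the closure, in
`H¹(G) × L²(∂G)`, of the pairs `(φ|_G, φ|_{∂G})` with `φ` smooth on the plane. -/
def IsTrace (G : Set Plane) (v : H1 G) (t : Lp ℂ 2 (bdry G)) : Prop :=
  (v, t) ∈ closure {q : H1 G × Lp ℂ 2 (bdry G) | ∃ φ : Plane → ℂ, ContDiff ℝ ∞ φ ∧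
    toL2 q.1.1 =ᵐ[volume.restrict G] φ ∧ q.2 =ᵐ[bdry G] φ}

/-! ### Bochner spaces and the two-scale equation -/

/-- The Bochner space `L²(Ω; X)`. -/
abbrev L2Bochner (Ω : Set Plane) (X : Type) [NormedAddCommGroup X] : Type :=
  Lp X 2 (volume.restrict Ω)

/-- `(∇_y v₁)(x, y)` for `v₁ ∈ L²(Ω; H¹_{♯,0}(Y*))`; relevant for `x ∈ Ω`, `y ∈ Y*`. -/
def gradY1 {Ω D : Set Plane} (v₁ : L2Bochner Ω (H1PerZero D)) (x y : Plane) : CVec :=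
  wgrad (v₁ x).1 y

/-- `(∇_y v₂)(x, y)` for `v₂ ∈ L²(Ω; H¹₀(D))`; relevant for `x ∈ Ω`, `y ∈ D`. -/
def gradY2 {Ω D : Set Plane} (v₂ : L2Bochner Ω (H10 D)) (x y : Plane) : CVec :=
  wgrad (v₂ x).1 y

/-- `χ_D(y) v₂(x, y)` for `v₂ ∈ L²(Ω; H¹₀(D))`, extended by zero to `x ∉ Ω`. -/
def chiD {Ω D : Set Plane} (v₂ : L2Bochner Ω (H10 D)) (x y : Plane) : ℂ :=
  Ω.indicator (fun x' => D.indicator (fun y' => toL2 (v₂ x').1 y') y) x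

/-- The two-scale sesquilinear form `𝓑((v, v₁, v₂), (ψ, ψ₁, ψ₂))`. The arguments `tv` and `tψ`
stand for the traces of `v` and `ψ` on `∂G`. -/
def twoScaleForm {D Ω G : Set Plane} (εi : ℂ) (εe k : ℝ)
    (v : H1 G) (tv : Lp ℂ 2 (bdry G))
    (v₁ : L2Bochner Ω (H1PerZero D)) (v₂ : L2Bochner Ω (H10 D))
    (ψ : H1 G) (tψ : Lp ℂ 2 (bdry G))
    (ψ₁ : L2Bochner Ω (H1PerZero D)) (ψ₂ : L2Bochner Ω (H10 D)) : ℂ :=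
  (∫ x in Ω, ∫ y in YStar D,
      (εe : ℂ)⁻¹ * dotConj (wgrad v.1 x + gradY1 v₁ x y) (wgrad ψ.1 x + gradY1 ψ₁ x y))
    + (∫ x in Ω, ∫ y in D, εi⁻¹ * dotConj (gradY2 v₂ x y) (gradY2 ψ₂ x y))
    - (k : ℂ) ^ 2 * (∫ x in G, ∫ y in cell,
        (toL2 v.1 x + chiD v₂ x y) * conj (toL2 ψ.1 x + chiD ψ₂ x y))
    + (∫ x in G \ closure Ω, dotConj (wgrad v.1 x) (wgrad ψ.1 x))
    - Complex.I * (k : ℂ) * ∫ x, tv x * conj (tψ x) ∂(bdry G)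

/-- `(u, u₁, u₂)` solves the two-scale equation with boundary datum `g`; the functions `u₁` and
`u₂` are then the correctors. -/
def IsTwoScaleSolution {D Ω G : Set Plane} (εi : ℂ) (εe k : ℝ) (g : Lp ℂ 2 (bdry G))
    (u : H1 G) (u₁ : L2Bochner Ω (H1PerZero D)) (u₂ : L2Bochner Ω (H10 D)) : Prop :=
  ∃ tu : Lp ℂ 2 (bdry G), IsTrace G u tu ∧
    ∀ (ψ : H1 G) (tψ : Lp ℂ 2 (bdry G)), IsTrace G ψ tψ →
      ∀ (ψ₁ : L2Bochner Ω (H1PerZero D)) (ψ₂ : L2Bochner Ω (H10 D)),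
        twoScaleForm εi εe k u tu u₁ u₂ ψ tψ ψ₁ ψ₂ = ∫ x, g x * conj (tψ x) ∂(bdry G)

/-- The norm `‖v‖_{1,k,s} = (‖∇v‖² + k² ‖v‖²)^(1/2)` on `H¹(s)`. -/
def normH1k {s : Set Plane} (k : ℝ) (v : H1 s) : ℝ :=
  Real.sqrt (‖wgrad v.1‖ ^ 2 + k ^ 2 * ‖toL2 v.1‖ ^ 2)

/-- The norm `‖v₂‖_{L²(Ω;1,k,D)} = (‖∇_y v₂‖²_{L²(Ω;L²(D))} + k² ‖v₂‖²_{L²(Ω;L²(D))})^(1/2)`. -/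
def normL2H1k {Ω D : Set Plane} (k : ℝ) (v₂ : L2Bochner Ω (H10 D)) : ℝ :=
  Real.sqrt ((∫ x in Ω, ‖wgrad (v₂ x).1‖ ^ 2) + k ^ 2 * ∫ x in Ω, ‖toL2 (v₂ x).1‖ ^ 2)

end TwoScale

end

open TwoScale

noncomputable section

namespace TwoScale

/-! ### Duality in `L²` -/

/-! Take `ψ = 0`, with trace zero, in the two-scale equation. The datum `g`, the boundary term and
the integral over `G \ closure Ω` drop out. Since `ψ₁` and `ψ₂` are independent, two cell problems
remain, posed in `L²(Ω; L²)` and driven by `∇u` and `u` seen as functions constant in `y`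
(`twoScaleForm_zero`). Their constants depend neither on `k` nor on `Ω` or `G`.

For `u₁`, testing with `u₁` gives `⟨∇_y u₁, ∇u + ∇_y u₁⟩ = 0`, so Cauchy–Schwarz bounds `∇_y u₁` by
`∇u`. The Poincaré–Wirtinger inequality on `Y*` (`exists_norm_toL2_le`), applied for almost every
`x`, then controls the full norm.

For `u₂`, testing with `u₂` gives `εi⁻¹ ‖∇_y u₂‖² = k² ⟨u₂, u + u₂⟩`. As `Im εi⁻¹ < 0`, the
imaginary part bounds `‖∇_y u₂‖²` by a multiple of `k² ‖u₂‖ ‖u‖`, and the real part then does the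
same for `k² ‖u₂‖²` (`energy_le_of_dissipative`).

Most of the work is Poincaré's inequality on `Y*`. On a region under a graph it follows by duality:
each test function `f` equals `(∫ f) ζ + ∂₁F₁ + ∂₂F₂`, with a fixed bump `ζ` of mass one and test
functions `F₁`, `F₂` bounded in `L²` by `f` (`exists_horizontal_primitive`,
`exists_vertical_primitive`). Hence `w - ∫ ζ w`, paired with `f`, sees only the weak gradient of `w`
(`exists_poincare_real`). Finitely many such regions, rotated and translated, make up `Y*`, and
connectedness glues their inequalities together (`isPoincare_biUnion`, `isPoincare_YStar`). -/

theorem abs_integral_mul_le_sqrt {α : Type*} [MeasurableSpace α] {μ : Measure α} {f g : α → ℝ}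
    (hf : MemLp f 2 μ) (hg : MemLp g 2 μ) :
    |∫ x, f x * g x ∂μ| ≤ √(∫ x, f x ^ 2 ∂μ) * √(∫ x, g x ^ 2 ∂μ) := by
  have h := integral_mul_norm_le_Lp_mul_Lq (μ := μ) (f := f) (g := g) Real.HolderConjugate.two_two
    (by simpa using hf) (by simpa using hg)
  have h2 : |∫ x, f x * g x ∂μ| ≤ ∫ x, ‖f x‖ * ‖g x‖ ∂μ := by
    simpa [abs_mul] using abs_integral_le_integral_abs (μ := μ) (f := fun x => f x * g x)
  simpa [Real.sqrt_eq_rpow] using h2.trans h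

/-- Test functions are dense in `L²(U)`, so the bound on the pairing extends by continuity to all of
`L²(U)`, in particular to `w` itself. -/
theorem integral_sq_le_of_forall_test {E : Type*} [NormedAddCommGroup E] [NormedSpace ℝ E]
    [FiniteDimensional ℝ E] [MeasurableSpace E] [BorelSpace E] {μ : Measure E}
    [IsFiniteMeasureOnCompacts μ] {U : Set E} (hU : IsOpen U) {w : E → ℝ}
    (hw : MemLp w 2 (μ.restrict U)) {M : ℝ}
    (h : ∀ φ : E → ℝ, ContDiff ℝ ∞ φ → HasCompactSupport φ → tsupport φ ⊆ U →
      |∫ x in U, w x * φ x ∂μ| ≤ M * √(∫ x in U, φ x ^ 2 ∂μ)) :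
    ∫ x in U, w x ^ 2 ∂μ ≤ M ^ 2 := by
  have htest : ∀ φ : E → ℝ, ContDiff ℝ ∞ φ → HasCompactSupport φ → MemLp φ 2 (μ.restrict U) :=
    fun φ h1 h2 => (h1.continuous.memLp_of_hasCompactSupport h2).mono_measure
      Measure.restrict_le_self
  let S : Submodule ℝ (Lp ℝ 2 (μ.restrict U)) :=
    { carrier := {f | ∃ φ : E → ℝ, ContDiff ℝ ∞ φ ∧ HasCompactSupport φ ∧ tsupport φ ⊆ U ∧
        f =ᵐ[μ.restrict U] φ}
      zero_mem' := ⟨0, contDiff_const, HasCompactSupport.zero, by simp [tsupport],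
        Lp.coeFn_zero _ _ _⟩
      add_mem' := by
        rintro f g ⟨φ, a1, a2, a3, a4⟩ ⟨ψ, b1, b2, b3, b4⟩
        exact ⟨φ + ψ, a1.add b1, a2.add b2, (tsupport_add φ ψ).trans (union_subset a3 b3),
          (Lp.coeFn_add f g).trans (a4.add b4)⟩
      smul_mem' := by
        rintro c f ⟨φ, a1, a2, a3, a4⟩
        exact ⟨c • φ, contDiff_const.smul a1, a2.smul_left (f := fun _ => c),
          (tsupport_smul_subset_right (fun _ => c) φ).trans a3,
          (Lp.coeFn_smul c f).trans (a4.const_smul c)⟩ }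
  have hinner : ∀ f g : Lp ℝ 2 (μ.restrict U), inner ℝ f g = ∫ x in U, f x * g x ∂μ := by
    intro f g
    rw [L2.inner_def]
    simp [mul_comm]
  have hnorm : ∀ f : Lp ℝ 2 (μ.restrict U), ‖f‖ = √(∫ x in U, f x ^ 2 ∂μ) := by
    intro f
    rw [norm_eq_sqrt_real_inner, hinner]
    simp [pow_two]
  -- Density, by the fundamental lemma of the calculus of variations: what is orthogonal to all test
  -- functions vanishes almost everywhere.
  have hperp : Sᗮ = ⊥ := by
    rw [Submodule.eq_bot_iff]
    intro f hf
    rw [Submodule.mem_orthogonal] at hf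
    have hloc : LocallyIntegrableOn f U μ := by
      rw [locallyIntegrableOn_iff hU.isLocallyClosed]
      intro K hKU hK
      have : IsFiniteMeasure (μ.restrict K) := ⟨by simpa using hK.measure_lt_top⟩
      exact ((Lp.memLp f).mono_measure (Measure.restrict_mono hKU le_rfl)).integrable (by norm_num)
    have h0 := hU.ae_eq_zero_of_integral_contDiff_smul_eq_zero hloc (fun g g1 g2 g3 => by
      have hg := htest g g1 g2
      have e := hf (hg.toLp g) ⟨g, g1, g2, g3, hg.coeFn_toLp⟩
      rw [hinner] at e
      rw [← setIntegral_eq_integral_of_forall_compl_eq_zero (s := U), ← e]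
      · refine integral_congr_ae ?_
        filter_upwards [hg.coeFn_toLp] with x hx
        rw [hx, smul_eq_mul]
      · intro x hx
        rw [image_eq_zero_of_notMem_tsupport (fun hx' => hx (g3 hx')), zero_smul])
    rw [Lp.eq_zero_iff_ae_eq_zero]
    exact (ae_restrict_iff' hU.measurableSet).2 h0
  have hdense : S.topologicalClosure = ⊤ := by
    rw [← Submodule.orthogonal_eq_bot_iff, Submodule.orthogonal_closure, hperp]
  set W := hw.toLp w
  have key : ∀ f ∈ S.topologicalClosure, |inner ℝ W f| ≤ M * ‖f‖ := by
    intro f hf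
    have hcl : IsClosed {f : Lp ℝ 2 (μ.restrict U) | |inner ℝ W f| ≤ M * ‖f‖} :=
      isClosed_le (by fun_prop) (by fun_prop)
    refine closure_minimal ?_ hcl hf
    rintro g ⟨φ, a1, a2, a3, a4⟩
    have e := h φ a1 a2 a3
    simp only [mem_ofPred_eq]
    rw [hinner, hnorm, integral_congr_ae (g := fun x => w x * φ x),
      integral_congr_ae (f := fun x => g x ^ 2) (g := fun x => φ x ^ 2)]
    · exact e
    · filter_upwards [a4] with x hx
      rw [hx]
    · filter_upwards [a4, hw.coeFn_toLp] with x hx hx'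
      rw [hx, hx']
  have kW := key W (by rw [hdense]; trivial)
  rw [real_inner_self_eq_norm_sq, abs_of_nonneg (by positivity)] at kW
  have hWw : ∫ x in U, w x ^ 2 ∂μ = ‖W‖ ^ 2 := by
    rw [← real_inner_self_eq_norm_sq, hinner]
    refine integral_congr_ae ?_
    filter_upwards [hw.coeFn_toLp] with x hx
    rw [hx, pow_two]
  rw [hWw]
  rcases (norm_nonneg W).eq_or_lt with h0 | h0
  · rw [← h0, zero_pow two_ne_zero]
    positivity
  · have : ‖W‖ ≤ M := by nlinarith
    gcongr

/-! ### Primitives depending on a parameter -/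

/-- The primitive in `t` is the convolution of `g (s, ·)` with the Heaviside function; smoothness in
the parameter `s` comes with the smoothness of convolutions. -/
theorem contDiff_setIntegral_Iic {g : ℝ × ℝ → ℝ} (hg : ContDiff ℝ ∞ g) {k : Set ℝ}
    (hk : IsCompact k) (h0 : ∀ s, ∀ t ∉ k, g (s, t) = 0) :
    ContDiff ℝ ∞ fun q : ℝ × ℝ => ∫ τ in Iic q.2, g (q.1, τ) := by
  have h := contDiffOn_convolution_right_with_param (n := ⊤) (μ := volume)
    (f := (Ici (0 : ℝ)).indicator fun _ => (1 : ℝ)) (ContinuousLinearMap.mul ℝ ℝ)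
    (g := fun s t => g (s, t)) (s := univ) isOpen_univ hk (fun s t _ => h0 s t)
    ((locallyIntegrable_const (1 : ℝ)).indicator measurableSet_Ici) hg.contDiffOn
  rw [univ_prod_univ, contDiffOn_univ] at h
  convert h using 2 with q
  rw [convolution_eq_swap, ← integral_indicator measurableSet_Iic]
  refine integral_congr_ae (Eventually.of_forall fun τ => ?_)
  by_cases hτ : τ ≤ q.2 <;> simp [indicator, hτ]

/-- The full integral is the primitive evaluated at a fixed upper bound of `k`. -/
theorem contDiff_integral_snd {g : ℝ × ℝ → ℝ} (hg : ContDiff ℝ ∞ g) {k : Set ℝ}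
    (hk : IsCompact k) (h0 : ∀ s, ∀ t ∉ k, g (s, t) = 0) :
    ContDiff ℝ ∞ fun s : ℝ => ∫ τ, g (s, τ) := by
  obtain ⟨B, hB⟩ := hk.bddAbove
  have h := (contDiff_setIntegral_Iic hg hk h0).comp
    (contDiff_id.prodMk contDiff_const : ContDiff ℝ ∞ fun s : ℝ => (s, B))
  convert h using 2 with s
  refine (setIntegral_eq_integral_of_forall_compl_eq_zero fun τ hτ => h0 s τ fun hk' => ?_).symm
  exact hτ (hB hk')

theorem hasDerivAt_setIntegral_Iic {g : ℝ → ℝ} (hg : Continuous g) (hi : Integrable g) (t : ℝ) :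
    HasDerivAt (fun t => ∫ τ in Iic t, g τ) (g t) t := by
  have h := (intervalIntegral.integral_hasDerivAt_right (hg.intervalIntegrable 0 t)
    (hg.stronglyMeasurableAtFilter _ _) hg.continuousAt).add_const (∫ τ in Iic 0, g τ)
  refine h.congr_of_eventuallyEq (Eventually.of_forall fun u => ?_)
  have := intervalIntegral.integral_Iic_sub_Iic (μ := volume) (f := g) (a := 0) (b := u)
    hi.integrableOn hi.integrableOn
  simp only
  linarith

theorem setIntegral_Iic_eq_zero_of_left {g : ℝ → ℝ} {t : ℝ} (h : ∀ τ ≤ t, g τ = 0) :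
    ∫ τ in Iic t, g τ = 0 :=
  (setIntegral_congr_fun measurableSet_Iic fun τ hτ => h τ hτ).trans (by simp)

theorem setIntegral_Iic_eq_zero_of_right {g : ℝ → ℝ} {t : ℝ} (h : ∀ τ, t < τ → g τ = 0)
    (h0 : ∫ τ, g τ = 0) : ∫ τ in Iic t, g τ = 0 :=
  (setIntegral_eq_integral_of_forall_compl_eq_zero fun τ hτ => h τ (not_le.1 hτ)).trans h0

theorem abs_setIntegral_Iic_le {g : ℝ → ℝ} (hi : Integrable g) (t : ℝ) :
    |∫ τ in Iic t, g τ| ≤ ∫ τ, |g τ| :=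
  (abs_integral_le_integral_abs).trans
    (setIntegral_le_integral hi.abs (Eventually.of_forall fun _ => abs_nonneg _))

theorem exists_smooth_unit_mass {a b : ℝ} (hab : a < b) :
    ∃ η : ℝ → ℝ, ContDiff ℝ ∞ η ∧ HasCompactSupport η ∧ tsupport η ⊆ Ioo a b ∧ (∀ t, 0 ≤ η t) ∧
      ∫ t, η t = 1 := by
  let B : ContDiffBump ((a + b) / 2) := ⟨(b - a) / 8, (b - a) / 4, by linarith, by linarith⟩
  refine ⟨B.normed volume, B.contDiff_normed, B.hasCompactSupport_normed, ?_, B.nonneg_normed,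
    B.integral_normed⟩
  rw [B.tsupport_normed_eq]
  intro t ht
  rw [Metric.mem_closedBall, Real.dist_eq, abs_le] at ht
  simp only [B] at ht
  constructor <;> linarith [ht.1, ht.2]

/-- Cauchy–Schwarz against the constant `1` on `Ioo a b`. -/
theorem sq_integral_abs_le {g : ℝ → ℝ} (hg : Continuous g) {a b : ℝ} (hab : a ≤ b)
    (h0 : ∀ t ∉ Ioo a b, g t = 0) : (∫ t, |g t|) ^ 2 ≤ (b - a) * ∫ t, g t ^ 2 := by
  have hm : MemLp g 2 (volume.restrict (Ioo a b)) :=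
    (hg.memLp_of_hasCompactSupport (HasCompactSupport.intro isCompact_Icc
      fun t ht => h0 t fun h => ht (Ioo_subset_Icc_self h))).mono_measure Measure.restrict_le_self
  have hfin : IsFiniteMeasure (volume.restrict (Ioo a b)) := ⟨by simp⟩
  have h := abs_integral_mul_le_sqrt hm.norm (memLp_const (1 : ℝ))
  have e1 : ∫ t in Ioo a b, ‖g t‖ * 1 = ∫ t, |g t| := by
    simp only [mul_one, Real.norm_eq_abs]
    exact setIntegral_eq_integral_of_forall_compl_eq_zero fun t ht => by rw [h0 t ht, abs_zero]
  have e2 : ∫ t in Ioo a b, ‖g t‖ ^ 2 = ∫ t, g t ^ 2 := by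
    simp only [Real.norm_eq_abs, sq_abs]
    exact setIntegral_eq_integral_of_forall_compl_eq_zero fun t ht => by rw [h0 t ht]; simp
  have e3 : ∫ _ in Ioo a b, (1 : ℝ) ^ 2 = b - a := by simp [hab]
  rw [e1, e2, e3, abs_of_nonneg (integral_nonneg fun _ => abs_nonneg _)] at h
  calc (∫ t, |g t|) ^ 2 ≤ (√(∫ t, g t ^ 2) * √(b - a)) ^ 2 := by
        gcongr
    _ = (b - a) * ∫ t, g t ^ 2 := by
        rw [mul_pow, Real.sq_sqrt (integral_nonneg fun _ => sq_nonneg _),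
          Real.sq_sqrt (sub_nonneg.2 hab), mul_comm]

theorem integral_sq_le_of_abs_le {g : ℝ → ℝ} {a b m : ℝ} (hab : a ≤ b)
    (h0 : ∀ t ∉ Ioo a b, g t = 0) (hm : ∀ t, |g t| ≤ m) : ∫ t, g t ^ 2 ≤ (b - a) * m ^ 2 := by
  rw [← setIntegral_eq_integral_of_forall_compl_eq_zero (s := Ioo a b)
    fun t ht => by rw [h0 t ht]; simp]
  have h := norm_setIntegral_le_of_norm_le_const (f := fun t => g t ^ 2) (C := m ^ 2)
    (μ := volume) (s := Ioo a b) (by simp) fun t _ => by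
      rw [norm_pow, Real.norm_eq_abs]
      gcongr
      exact hm t
  refine (le_abs_self _).trans (h.trans_eq ?_)
  simp [measureReal_def, hab, mul_comm]

/-- The primitive of a test function of mean zero is a test function. -/
theorem tsupport_primitive_subset {g : ℝ → ℝ} (hc : HasCompactSupport g) (h0 : ∫ τ, g τ = 0) :
    tsupport (fun s => ∫ τ in Iic s, g τ) ⊆ Icc (sInf (tsupport g)) (sSup (tsupport g)) := by
  have hK : IsCompact (tsupport g) := hc
  refine closure_minimal (fun s hs => ?_) isClosed_Icc
  by_contra hns
  refine hs ?_
  rw [mem_Icc, not_and_or, not_le, not_le] at hns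
  rcases hns with h | h
  · exact setIntegral_Iic_eq_zero_of_left fun σ hσ => image_eq_zero_of_notMem_tsupport fun hσ' =>
      ((csInf_le hK.bddBelow hσ').trans hσ).not_gt h
  · exact setIntegral_Iic_eq_zero_of_right (fun σ hσ => image_eq_zero_of_notMem_tsupport fun hσ' =>
      ((le_csSup hK.bddAbove hσ').trans_lt h).not_gt hσ) h0

/-! ### Regions under a graph and their test functions -/

/-- The union of the vertical segments joining two points of `K`. -/
def verticalHull (K : Set (ℝ × ℝ)) : Set (ℝ × ℝ) :=
  {p | ∃ t₁ t₂, (p.1, t₁) ∈ K ∧ (p.1, t₂) ∈ K ∧ p.2 ∈ Icc t₁ t₂}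

/-- The hull is a continuous image of a compact set: ordered pairs of points of `K` on a common
vertical line, times the parameter interval `[0, 1]` of the segment joining them. -/
theorem isCompact_verticalHull {K : Set (ℝ × ℝ)} (hK : IsCompact K) :
    IsCompact (verticalHull K) := by
  have h1 : IsCompact (((K ×ˢ K) ∩ {x | x.1.1 = x.2.1 ∧ x.1.2 ≤ x.2.2}) ×ˢ Icc (0 : ℝ) 1) := by
    refine IsCompact.prod ((hK.prod hK).inter_right ?_) isCompact_Icc
    exact (isClosed_eq (f := fun x : (ℝ × ℝ) × (ℝ × ℝ) => x.1.1) (g := fun x => x.2.1)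
      (by fun_prop) (by fun_prop)).inter (isClosed_le (f := fun x : (ℝ × ℝ) × (ℝ × ℝ) => x.1.2)
      (g := fun x => x.2.2) (by fun_prop) (by fun_prop))
  have h2 := h1.image (f := fun x : ((ℝ × ℝ) × (ℝ × ℝ)) × ℝ =>
    (x.1.1.1, x.1.1.2 + x.2 * (x.1.2.2 - x.1.1.2))) (by fun_prop)
  convert h2 using 1
  ext ⟨s, t⟩
  constructor
  · rintro ⟨t₁, t₂, k1, k2, k3⟩
    have hseg : t ∈ segment ℝ t₁ t₂ := by rwa [segment_eq_Icc (k3.1.trans k3.2)]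
    rw [segment_eq_image'] at hseg
    obtain ⟨θ, hθ, rfl⟩ := hseg
    exact ⟨(((s, t₁), (s, t₂)), θ), ⟨⟨⟨k1, k2⟩, rfl, k3.1.trans k3.2⟩, hθ⟩, rfl⟩
  · rintro ⟨⟨⟨⟨s₁, t₁⟩, ⟨s₂, t₂⟩⟩, θ⟩, ⟨⟨⟨k1, k2⟩, k3, k4⟩, hθ⟩, he⟩
    simp only [Prod.mk.injEq] at he k3 k4 k1 k2 hθ
    obtain ⟨rfl, rfl⟩ := he
    subst k3
    exact ⟨t₁, t₂, k1, k2, by nlinarith [hθ.1], by nlinarith [hθ.2]⟩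

/-- The region `{(s, t) | α < s < β, a < t < γ s}`. -/
def subgraph (α β a : ℝ) (γ : ℝ → ℝ) : Set (ℝ × ℝ) :=
  {p | p.1 ∈ Ioo α β ∧ p.2 ∈ Ioo a (γ p.1)}

theorem isOpen_subgraph {α β a : ℝ} {γ : ℝ → ℝ} (hγ : Continuous γ) :
    IsOpen (subgraph α β a γ) :=
  (isOpen_Ioo.preimage continuous_fst).inter
    ((isOpen_lt continuous_const continuous_snd).inter
      (isOpen_lt continuous_snd (hγ.comp continuous_fst)))

theorem verticalHull_subset_subgraph {α β a : ℝ} {γ : ℝ → ℝ} {K : Set (ℝ × ℝ)}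
    (hK : K ⊆ subgraph α β a γ) : verticalHull K ⊆ subgraph α β a γ := by
  rintro ⟨s, t⟩ ⟨t₁, t₂, k1, k2, k3⟩
  exact ⟨(hK k1).1, (hK k1).2.1.trans_le k3.1, k3.2.trans_lt (hK k2).2.2⟩

/-- Test functions on `U`. -/
structure IsTest {E : Type*} [NormedAddCommGroup E] [NormedSpace ℝ E] (U : Set E) (φ : E → ℝ) :
    Prop where
  contDiff : ContDiff ℝ ∞ φ
  hasCompactSupport : HasCompactSupport φ
  tsupport_subset : tsupport φ ⊆ U

theorem IsTest.eq_zero {E : Type*} [NormedAddCommGroup E] [NormedSpace ℝ E] {U : Set E}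
    {φ : E → ℝ} (h : IsTest U φ) {x : E} (hx : x ∉ U) : φ x = 0 :=
  image_eq_zero_of_notMem_tsupport fun h' => hx (h.tsupport_subset h')

theorem IsTest.integrable_sq {E : Type*} [NormedAddCommGroup E] [NormedSpace ℝ E]
    [MeasurableSpace E] [OpensMeasurableSpace E] {μ : Measure E} [IsFiniteMeasureOnCompacts μ]
    {U : Set E} {φ : E → ℝ} (h : IsTest U φ) :
    Integrable (fun x => φ x ^ 2) μ := by
  simp only [pow_two]
  exact (h.contDiff.continuous.mul h.contDiff.continuous).integrable_of_hasCompactSupport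
    h.hasCompactSupport.mul_left

theorem IsTest.integrable {E : Type*} [NormedAddCommGroup E] [NormedSpace ℝ E]
    [MeasurableSpace E] [OpensMeasurableSpace E] {μ : Measure E} [IsFiniteMeasureOnCompacts μ]
    {U : Set E} {φ : E → ℝ} (h : IsTest U φ) : Integrable φ μ :=
  h.contDiff.continuous.integrable_of_hasCompactSupport h.hasCompactSupport

theorem IsTest.exists_primitive {α β : ℝ} {g : ℝ → ℝ} (hg : IsTest (Ioo α β) g)
    (h0 : ∫ τ, g τ = 0) : ∃ A : ℝ → ℝ, IsTest (Ioo α β) A ∧ (∀ s, HasDerivAt A (g s) s) ∧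
      ∀ s, |A s| ≤ ∫ τ, |g τ| := by
  have hd : ∀ s, HasDerivAt (fun s => ∫ τ in Iic s, g τ) (g s) s := fun s =>
    hasDerivAt_setIntegral_Iic hg.contDiff.continuous hg.integrable s
  have hs := tsupport_primitive_subset hg.hasCompactSupport h0
  have hK : IsCompact (tsupport g) := hg.hasCompactSupport
  -- For empty support both `sInf` and `sSup` take the default value `0`, which need not lie in `Ioo
  -- α β`.
  rcases (tsupport g).eq_empty_or_nonempty with he | hne
  · rw [tsupport_eq_empty_iff] at he
    subst he
    exact ⟨0, hg, fun s => hasDerivAt_const s (0 : ℝ), fun s => by simp⟩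
  refine ⟨fun s => ∫ τ in Iic s, g τ, ⟨?_, ?_, ?_⟩, hd, abs_setIntegral_Iic_le hg.integrable⟩
  · rw [contDiff_infty_iff_deriv]
    refine ⟨fun s => (hd s).differentiableAt, ?_⟩
    rw [show deriv _ = g from funext fun s => (hd s).deriv]
    exact hg.contDiff
  · exact isCompact_Icc.of_isClosed_subset (isClosed_tsupport _) hs
  · exact hs.trans fun s hs' => ⟨(hg.tsupport_subset (hK.sInf_mem hne)).1.trans_le hs'.1,
      hs'.2.trans_lt (hg.tsupport_subset (hK.sSup_mem hne)).2⟩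

/-- Slice integrals of a test function on a subgraph. -/
theorem IsTest.slice {α β a T : ℝ} {γ : ℝ → ℝ} (hT : ∀ s ∈ Ioo α β, γ s ≤ T) {f : ℝ × ℝ → ℝ}
    (hf : IsTest (subgraph α β a γ) f) (s : ℝ) :
    IsTest (Ioo a T) (fun t => f (s, t)) := by
  have hsub : tsupport (fun t => f (s, t)) ⊆ (fun t => (s, t)) ⁻¹' tsupport f :=
    tsupport_comp_subset_preimage f (by fun_prop)
  have hcl : tsupport (fun t => f (s, t)) ⊆ Prod.snd '' tsupport f :=
    fun t ht => ⟨(s, t), hsub ht, rfl⟩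
  refine ⟨hf.contDiff.comp (contDiff_const.prodMk contDiff_id),
    (hf.hasCompactSupport.isCompact.image continuous_snd).of_isClosed_subset
      (isClosed_tsupport _) hcl, fun t ht => ?_⟩
  have h := hf.tsupport_subset (hsub ht)
  exact ⟨h.2.1, h.2.2.trans_le (hT s h.1)⟩

theorem IsTest.integral_snd {α β a : ℝ} {γ : ℝ → ℝ} {f : ℝ × ℝ → ℝ}
    (hf : IsTest (subgraph α β a γ) f) : IsTest (Ioo α β) (fun s => ∫ t, f (s, t)) := by
  have hK := hf.hasCompactSupport.isCompact
  have hsub : tsupport (fun s => ∫ t, f (s, t)) ⊆ Prod.fst '' tsupport f := by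
    refine closure_minimal (fun s hs => ?_) (hK.image continuous_fst).isClosed
    by_contra hns
    refine hs ?_
    simp only
    rw [integral_congr_ae (g := fun _ => 0), integral_zero]
    exact Eventually.of_forall fun t =>
      image_eq_zero_of_notMem_tsupport fun h => hns ⟨(s, t), h, rfl⟩
  refine ⟨contDiff_integral_snd hf.contDiff (hK.image continuous_snd) fun s t ht =>
      image_eq_zero_of_notMem_tsupport fun h => ht ⟨(s, t), h, rfl⟩,
    (hK.image continuous_fst).of_isClosed_subset (isClosed_tsupport _) hsub, ?_⟩
  rintro s hs
  obtain ⟨p, hp, rfl⟩ := hsub hs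
  exact (hf.tsupport_subset hp).1

theorem IsTest.sub {E : Type*} [NormedAddCommGroup E] [NormedSpace ℝ E] {U : Set E}
    {φ ψ : E → ℝ} (h : IsTest U φ) (h' : IsTest U ψ) : IsTest U (fun x => φ x - ψ x) := by
  refine ⟨h.contDiff.sub h'.contDiff, h.hasCompactSupport.sub h'.hasCompactSupport, ?_⟩
  exact (tsupport_sub φ ψ).trans (union_subset h.tsupport_subset h'.tsupport_subset)

theorem IsTest.const_mul {E : Type*} [NormedAddCommGroup E] [NormedSpace ℝ E] {U : Set E}
    {φ : E → ℝ} (h : IsTest U φ) (c : ℝ) : IsTest U (fun x => c * φ x) :=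
  ⟨contDiff_const.mul h.contDiff, h.hasCompactSupport.mul_left,
    (tsupport_mul_subset_right (f := fun _ => c) (g := φ)).trans h.tsupport_subset⟩

/-- The rectangle `Ioo α β ×ˢ Ioo a b` lies below the graph, so the product stays supported in the
region. -/
theorem IsTest.prod_mul {α β a b : ℝ} {γ : ℝ → ℝ} (hb : ∀ s ∈ Ioo α β, b ≤ γ s) {A η : ℝ → ℝ}
    (hA : IsTest (Ioo α β) A) (hη : IsTest (Ioo a b) η) :
    IsTest (subgraph α β a γ) (fun p => A p.1 * η p.2) := by
  have hsub : tsupport (fun p : ℝ × ℝ => A p.1 * η p.2) ⊆ tsupport A ×ˢ tsupport η := by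
    refine closure_minimal (fun p hp => ?_) ((isClosed_tsupport A).prod (isClosed_tsupport η))
    rw [Function.mem_support] at hp
    exact ⟨subset_tsupport _ (left_ne_zero_of_mul hp), subset_tsupport _ (right_ne_zero_of_mul hp)⟩
  refine ⟨(hA.contDiff.comp contDiff_fst).mul (hη.contDiff.comp contDiff_snd),
    (hA.hasCompactSupport.isCompact.prod hη.hasCompactSupport.isCompact).of_isClosed_subset
      (isClosed_tsupport _) hsub, fun p hp => ?_⟩
  have h1 := hA.tsupport_subset (hsub hp).1
  have h2 := hη.tsupport_subset (hsub hp).2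
  exact ⟨h1, h2.1, h2.2.trans_le (hb _ h1)⟩

/-! ### Decomposition of a test function into a divergence and a multiple of a bump -/

theorem fderiv_apply_one_zero {F : ℝ × ℝ → ℝ} {p : ℝ × ℝ} (hF : DifferentiableAt ℝ F p) {d : ℝ}
    (h : HasDerivAt (fun s => F (s, p.2)) d p.1) : fderiv ℝ F p (1, 0) = d := by
  have h1 : HasDerivAt (fun s : ℝ => (s, p.2)) ((1 : ℝ), (0 : ℝ)) p.1 :=
    (hasDerivAt_id p.1).prodMk (hasDerivAt_const p.1 p.2)
  exact (HasFDerivAt.comp_hasDerivAt p.1 (f := fun s => (s, p.2)) hF.hasFDerivAt h1).unique h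

theorem fderiv_apply_zero_one {F : ℝ × ℝ → ℝ} {p : ℝ × ℝ} (hF : DifferentiableAt ℝ F p) {d : ℝ}
    (h : HasDerivAt (fun t => F (p.1, t)) d p.2) : fderiv ℝ F p (0, 1) = d := by
  have h1 : HasDerivAt (fun t : ℝ => (p.1, t)) ((0 : ℝ), (1 : ℝ)) p.2 :=
    (hasDerivAt_const p.2 p.1).prodMk (hasDerivAt_id p.2)
  exact (HasFDerivAt.comp_hasDerivAt p.2 (f := fun t => (p.1, t)) hF.hasFDerivAt h1).unique h

theorem sq_slice_integral_le {α β a T : ℝ} (haT : a ≤ T) {γ : ℝ → ℝ}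
    (hT : ∀ s ∈ Ioo α β, γ s ≤ T) {f : ℝ × ℝ → ℝ} (hf : IsTest (subgraph α β a γ) f) (s : ℝ) :
    (∫ t, |f (s, t)|) ^ 2 ≤ (T - a) * ∫ t, f (s, t) ^ 2 :=
  sq_integral_abs_le (hf.slice hT s).contDiff.continuous haT fun _ ht => (hf.slice hT s).eq_zero ht

/-- The horizontal part of the divergence decomposition. -/
theorem exists_horizontal_primitive {α β a b T : ℝ} {γ : ℝ → ℝ} (hαβ : α ≤ β) (haT : a ≤ T)
    (hb : ∀ s ∈ Ioo α β, b ≤ γ s) (hT : ∀ s ∈ Ioo α β, γ s ≤ T) {η₁ η : ℝ → ℝ}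
    (hη₁ : IsTest (Ioo α β) η₁) (h0η₁ : ∀ t, 0 ≤ η₁ t) (h1η₁ : ∫ t, η₁ t = 1)
    (hη : IsTest (Ioo a b) η) {f : ℝ × ℝ → ℝ} (hf : IsTest (subgraph α β a γ) f) :
    ∃ F, IsTest (subgraph α β a γ) F ∧
      (∀ p : ℝ × ℝ, fderiv ℝ F p (1, 0) =
        (∫ t, f (p.1, t)) * η p.2 - (∫ q, f q) * (η₁ p.1 * η p.2)) ∧
      ∫ p, F p ^ 2 ≤ ((∫ t, η t ^ 2) * ((β - α) * 4 * ((β - α) * (T - a)))) * ∫ p, f p ^ 2 := by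
  set f₁ : ℝ → ℝ := fun s => ∫ t, f (s, t) with hf₁def
  have hf₁ : IsTest (Ioo α β) f₁ := hf.integral_snd
  set J := ∫ q, f q with hJ
  have hJf₁ : ∫ s, f₁ s = J := by
    rw [hJ, Measure.volume_eq_prod, integral_prod]
    exact hf.integrable
  -- Removing the multiple of `η₁` with the same mass leaves mean zero, so the primitive `A` has
  -- compact support again; the potential is `A s * η t`.
  have hg : IsTest (Ioo α β) (fun s => f₁ s - J * η₁ s) := hf₁.sub (hη₁.const_mul J)
  have hg0 : ∫ s, (f₁ s - J * η₁ s) = 0 := by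
    rw [integral_sub hf₁.integrable (hη₁.const_mul J).integrable, integral_const_mul, h1η₁, hJf₁]
    ring
  obtain ⟨A, hA, hAd, hAb⟩ := hg.exists_primitive hg0
  have hF := hA.prod_mul hb hη
  refine ⟨_, hF, fun p => ?_, ?_⟩
  · have := (hAd p.1).mul_const (η p.2)
    rw [fderiv_apply_one_zero (hF.contDiff.differentiable (by simp) p) this]
    ring
  · have hJle : |J| ≤ ∫ s, |f₁ s| := hJf₁ ▸ abs_integral_le_integral_abs
    -- The factor `2`: since `η₁` has mass one, `J * η₁` costs at most another `∫ |f₁|`.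
    have hAb' : ∀ s, |A s| ≤ 2 * ∫ s, |f₁ s| := fun s => by
      refine (hAb s).trans ?_
      have : ∫ τ, |f₁ τ - J * η₁ τ| ≤ ∫ τ, (|f₁ τ| + |J| * η₁ τ) := by
        refine integral_mono hg.integrable.abs
          (hf₁.integrable.abs.add (hη₁.const_mul _).integrable) fun τ => ?_
        refine (abs_sub _ _).trans_eq ?_
        rw [abs_mul, abs_of_nonneg (h0η₁ τ)]
      refine this.trans ?_
      rw [integral_add hf₁.integrable.abs (hη₁.const_mul _).integrable, integral_const_mul, h1η₁]
      linarith
    have hf₁sq : ∫ s, f₁ s ^ 2 ≤ (T - a) * ∫ p, f p ^ 2 := by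
      rw [Measure.volume_eq_prod, integral_prod _ hf.integrable_sq, ← integral_const_mul]
      refine integral_mono hf₁.integrable_sq (hf.integrable_sq.integral_prod_left.const_mul _) ?_
      intro s
      refine le_trans ?_ (sq_slice_integral_le haT hT hf s)
      change f₁ s ^ 2 ≤ _
      rw [← sq_abs (f₁ s)]
      have : |f₁ s| ≤ ∫ t, |f (s, t)| := abs_integral_le_integral_abs
      gcongr
    -- `(β - α) * 4` comes from squaring the sup bound and integrating over the interval; `β - α`
    -- and `T - a` come from Cauchy–Schwarz in `s` and in `t`.
    have hAsq : ∫ s, A s ^ 2 ≤ (β - α) * 4 * ((β - α) * (T - a)) * ∫ p, f p ^ 2 := by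
      refine (integral_sq_le_of_abs_le hαβ (fun s hs => hA.eq_zero hs) hAb').trans ?_
      have h1 := sq_integral_abs_le hf₁.contDiff.continuous hαβ (fun s hs => hf₁.eq_zero hs)
      have h2 := h1.trans (mul_le_mul_of_nonneg_left hf₁sq (sub_nonneg.2 hαβ))
      have h3 := mul_le_mul_of_nonneg_left h2 (mul_nonneg (sub_nonneg.2 hαβ) zero_le_four)
      linarith
    have e : ∫ p : ℝ × ℝ, (A p.1 * η p.2) ^ 2 = (∫ s, A s ^ 2) * ∫ t, η t ^ 2 := by
      simp only [mul_pow]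
      rw [Measure.volume_eq_prod]
      exact integral_prod_mul (fun s => A s ^ 2) (fun t => η t ^ 2)
    rw [e]
    have := mul_le_mul_of_nonneg_right hAsq (integral_nonneg (μ := volume) fun t => sq_nonneg (η t))
    linarith

/-- The vertical part of the divergence decomposition. -/
theorem exists_vertical_primitive {α β a b T : ℝ} {γ : ℝ → ℝ} (haT : a ≤ T)
    (hb : ∀ s ∈ Ioo α β, b ≤ γ s) (hT : ∀ s ∈ Ioo α β, γ s ≤ T) {η : ℝ → ℝ}
    (hη : IsTest (Ioo a b) η) (h0η : ∀ t, 0 ≤ η t) (h1η : ∫ t, η t = 1) {f : ℝ × ℝ → ℝ}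
    (hf : IsTest (subgraph α β a γ) f) :
    ∃ F, IsTest (subgraph α β a γ) F ∧
      (∀ p : ℝ × ℝ, fderiv ℝ F p (0, 1) = f p - (∫ t, f (p.1, t)) * η p.2) ∧
      ∫ p, F p ^ 2 ≤ (4 * (T - a) ^ 2) * ∫ p, f p ^ 2 := by
  have hf₁ := hf.integral_snd
  set f₁ : ℝ → ℝ := fun s => ∫ t, f (s, t) with hf₁def
  set g : ℝ × ℝ → ℝ := fun p => f p - f₁ p.1 * η p.2
  have hg : IsTest (subgraph α β a γ) g := hf.sub (hf₁.prod_mul hb hη)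
  have hgs : ∀ s, IsTest (Ioo a T) (fun t => g (s, t)) := hg.slice hT
  -- Mean zero on every vertical slice, so the vertical primitive returns to zero above the support.
  have hg0 : ∀ s, ∫ t, g (s, t) = 0 := by
    intro s
    simp only [g]
    rw [integral_sub (hf.slice hT s).integrable (hη.const_mul _).integrable, integral_const_mul,
      h1η]
    simp [hf₁def]
  have hK : IsCompact (tsupport g) := hg.hasCompactSupport
  have hgK : ∀ s, ∀ t ∉ Prod.snd '' tsupport g, g (s, t) = 0 := fun s t ht =>
    image_eq_zero_of_notMem_tsupport fun h => ht ⟨(s, t), h, rfl⟩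
  set F : ℝ × ℝ → ℝ := fun q => ∫ τ in Iic q.2, g (q.1, τ) with hFdef
  -- Off the hull, the support on the vertical line through `p` lies entirely below `p` or entirely
  -- above it; the primitive is then the full slice integral, which is zero, or the integral of
  -- zero.
  have hF0 : ∀ p ∉ verticalHull (tsupport g), F p = 0 := by
    rintro ⟨s, t⟩ hp
    by_cases h : ∃ τ, (s, τ) ∈ tsupport g ∧ τ ≤ t
    · obtain ⟨τ, hτ, hτt⟩ := h
      refine setIntegral_Iic_eq_zero_of_right (fun σ hσ => ?_) (hg0 s)
      exact image_eq_zero_of_notMem_tsupport fun hσ' => hp ⟨τ, σ, hτ, hσ', hτt, hσ.le⟩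
    · push Not at h
      refine setIntegral_Iic_eq_zero_of_left fun σ hσ => ?_
      exact image_eq_zero_of_notMem_tsupport fun hσ' => (h σ hσ').not_ge hσ
  have hFs : tsupport F ⊆ verticalHull (tsupport g) :=
    closure_minimal (fun p hp => by_contra fun h => hp (hF0 p h))
      (isCompact_verticalHull hK).isClosed
  have hF : IsTest (subgraph α β a γ) F :=
    ⟨contDiff_setIntegral_Iic hg.contDiff (hK.image continuous_snd) hgK,
      (isCompact_verticalHull hK).of_isClosed_subset (isClosed_tsupport _) hFs,
      hFs.trans (verticalHull_subset_subgraph hg.tsupport_subset)⟩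
  refine ⟨F, hF, fun p => ?_, ?_⟩
  · exact fderiv_apply_zero_one (hF.contDiff.differentiable (by simp) p)
      (hasDerivAt_setIntegral_Iic (hgs p.1).contDiff.continuous (hgs p.1).integrable p.2)
  · rw [Measure.volume_eq_prod, integral_prod _ hF.integrable_sq, integral_prod _ hf.integrable_sq,
      ← integral_const_mul]
    refine integral_mono hF.integrable_sq.integral_prod_left
      (hf.integrable_sq.integral_prod_left.const_mul _) fun s => ?_
    have hm : ∀ t, |F (s, t)| ≤ 2 * ∫ τ, |f (s, τ)| := fun t => by
      refine (abs_setIntegral_Iic_le (hgs s).integrable t).trans ?_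
      have h1 : |f₁ s| ≤ ∫ t, |f (s, t)| := abs_integral_le_integral_abs
      have h2 : ∫ τ, |g (s, τ)| ≤ ∫ τ, (|f (s, τ)| + |f₁ s| * η τ) := by
        refine integral_mono (hgs s).integrable.abs
          ((hf.slice hT s).integrable.abs.add (hη.const_mul _).integrable) fun τ => ?_
        refine (abs_sub _ _).trans_eq ?_
        rw [abs_mul, abs_of_nonneg (h0η τ)]
      refine h2.trans ?_
      rw [integral_add (hf.slice hT s).integrable.abs (hη.const_mul _).integrable,
        integral_const_mul, h1η]
      linarith
    have h3 := integral_sq_le_of_abs_le haT (fun t ht => (hF.slice hT s).eq_zero ht) hm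
    have h4 := mul_le_mul_of_nonneg_left (sq_slice_integral_le haT hT hf s)
      (mul_nonneg (sub_nonneg.2 haT) zero_le_four)
    simp only
    linarith

theorem IsTest.fderiv_apply {E : Type*} [NormedAddCommGroup E] [NormedSpace ℝ E] {U : Set E} {φ : E → ℝ} (h : IsTest U φ) (a : E) :
    IsTest U (fun x => fderiv ℝ φ x a) :=
  ⟨(h.contDiff.fderiv_right (m := ∞) (by simp)).clm_apply contDiff_const,
    h.hasCompactSupport.of_isClosed_subset (isClosed_tsupport _)
      (tsupport_fderiv_apply_subset ℝ a),
    (tsupport_fderiv_apply_subset ℝ a).trans h.tsupport_subset⟩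

/-! ### Weak directional derivatives -/

section WeakDeriv

variable {E F F' : Type*} [NormedAddCommGroup E] [NormedSpace ℝ E] [MeasureSpace E]
  [NormedAddCommGroup F] [NormedSpace ℝ F] [NormedAddCommGroup F'] [NormedSpace ℝ F']

/-- `q` is the weak derivative of `w` on `U` in the direction `a`. -/
def HasWeakDeriv (U : Set E) (a : E) (w q : E → F) : Prop :=
  ∀ φ : E → ℝ, IsTest U φ → ∫ x in U, fderiv ℝ φ x a • w x = -∫ x in U, φ x • q x

theorem IsTest.setIntegral_eq {U : Set E} {φ : E → ℝ} (h : IsTest U φ) :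
    ∫ x in U, φ x = ∫ x, φ x :=
  setIntegral_eq_integral_of_forall_compl_eq_zero fun _ hx => h.eq_zero hx

theorem IsTest.setIntegral_sq_eq {U : Set E} {φ : E → ℝ} (h : IsTest U φ) :
    ∫ x in U, φ x ^ 2 = ∫ x, φ x ^ 2 :=
  setIntegral_eq_integral_of_forall_compl_eq_zero fun _ hx => by rw [h.eq_zero hx]; simp

variable [BorelSpace E] [IsFiniteMeasureOnCompacts (volume : Measure E)]

theorem IsTest.memLp {U : Set E} {φ : E → ℝ} (h : IsTest U φ) :
    MemLp φ 2 (volume.restrict U) :=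
  (h.contDiff.continuous.memLp_of_hasCompactSupport h.hasCompactSupport).mono_measure
    Measure.restrict_le_self

theorem IsTest.integrable_smul {U : Set E} {φ : E → ℝ} (h : IsTest U φ) {w : E → F}
    (hw : MemLp w 2 (volume.restrict U)) : IntegrableOn (fun x => φ x • w x) U :=
  memLp_one_iff_integrable.1 (hw.smul h.memLp)

theorem HasWeakDeriv.comp_clm [CompleteSpace F] [CompleteSpace F'] {U : Set E} {a : E}
    {w q : E → F} (h : HasWeakDeriv U a w q) (hw : MemLp w 2 (volume.restrict U))
    (hq : MemLp q 2 (volume.restrict U)) (L : F →L[ℝ] F') :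
    HasWeakDeriv U a (fun x => L (w x)) (fun x => L (q x)) := by
  intro φ hφ
  simp_rw [← L.map_smul]
  rw [L.integral_comp_comm ((hφ.fderiv_apply a).integrable_smul hw),
    L.integral_comp_comm (hφ.integrable_smul hq), h φ hφ, map_neg]

end WeakDeriv

/-! ### Poincaré's inequality on a region under a graph -/

theorem measure_subgraph_lt_top {α β a T : ℝ} {γ : ℝ → ℝ} (hT : ∀ s ∈ Ioo α β, γ s ≤ T) :
    volume (subgraph α β a γ) < ⊤ := by
  refine (measure_mono (t := Icc α β ×ˢ Icc a T) ?_).trans_lt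
    (isCompact_Icc.prod isCompact_Icc).measure_lt_top
  rintro p ⟨h1, h2⟩
  exact ⟨Ioo_subset_Icc_self h1, h2.1.le, h2.2.le.trans (hT _ h1)⟩

/-- Poincaré's inequality on the region between a horizontal segment and a continuous graph. -/
theorem exists_poincare_real {α β a b T : ℝ} {γ : ℝ → ℝ} (hαβ : α < β) (hab : a < b)
    (hγ : Continuous γ) (hb : ∀ s ∈ Ioo α β, b ≤ γ s) (hT : ∀ s ∈ Ioo α β, γ s ≤ T) :
    ∃ C : ℝ, ∀ w q₁ q₂ : ℝ × ℝ → ℝ, MemLp w 2 (volume.restrict (subgraph α β a γ)) →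
      MemLp q₁ 2 (volume.restrict (subgraph α β a γ)) →
      MemLp q₂ 2 (volume.restrict (subgraph α β a γ)) →
      HasWeakDeriv (subgraph α β a γ) (1, 0) w q₁ → HasWeakDeriv (subgraph α β a γ) (0, 1) w q₂ →
      ∃ c : ℝ, ∫ x in subgraph α β a γ, (w x - c) ^ 2 ≤
        C * ((∫ x in subgraph α β a γ, q₁ x ^ 2) + ∫ x in subgraph α β a γ, q₂ x ^ 2) := by
  have haT : a ≤ T := by
    have hm : (α + β) / 2 ∈ Ioo α β := ⟨by linarith, by linarith⟩
    linarith [hb _ hm, hT _ hm]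
  set U := subgraph α β a γ with hU
  have hfin : IsFiniteMeasure (volume.restrict U) :=
    ⟨by simpa using measure_subgraph_lt_top hT⟩
  obtain ⟨η₁, a1, a2, a3, a4, a5⟩ := exists_smooth_unit_mass hαβ
  obtain ⟨η, b1, b2, b3, b4, b5⟩ := exists_smooth_unit_mass hab
  have hη₁ : IsTest (Ioo α β) η₁ := ⟨a1, a2, a3⟩
  have hη : IsTest (Ioo a b) η := ⟨b1, b2, b3⟩
  have hζ : IsTest U (fun p => η₁ p.1 * η p.2) := hη₁.prod_mul hb hη
  set C₁ := (∫ t, η t ^ 2) * ((β - α) * 4 * ((β - α) * (T - a))) with hC₁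
  set C₂ := 4 * (T - a) ^ 2 with hC₂
  refine ⟨2 * max C₁ C₂, fun w q₁ q₂ hw hq₁ hq₂ h₁ h₂ => ?_⟩
  -- The subtracted constant is a weighted mean whose weight is the bump of the decomposition; this
  -- makes its contribution cancel in the pairing below.
  set c := ∫ x in U, (η₁ x.1 * η x.2) * w x with hc
  have hζw : IntegrableOn (fun x => (η₁ x.1 * η x.2) * w x) U := hζ.integrable_smul hw
  refine ⟨c, ?_⟩
  have hC₂0 : 0 ≤ C₂ := by positivity
  have hC0 : 0 ≤ max C₁ C₂ := hC₂0.trans (le_max_right _ _)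
  have hQ₁ : 0 ≤ ∫ x in U, q₁ x ^ 2 := integral_nonneg fun x => sq_nonneg _
  have hQ₂ : 0 ≤ ∫ x in U, q₂ x ^ 2 := integral_nonneg fun x => sq_nonneg _
  refine (integral_sq_le_of_forall_test (isOpen_subgraph hγ) (hw.sub (memLp_const c))
    (M := √(max C₁ C₂) * (√(∫ x in U, q₁ x ^ 2) + √(∫ x in U, q₂ x ^ 2))) ?_).trans ?_
  · intro f f1 f2 f3
    have hf : IsTest U f := ⟨f1, f2, f3⟩
    obtain ⟨F₁, hF₁, hd₁, hl₁⟩ :=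
      exists_horizontal_primitive hαβ.le haT hb hT hη₁ a4 a5 hη hf
    obtain ⟨F₂, hF₂, hd₂, hl₂⟩ := exists_vertical_primitive haT hb hT hη b4 b5 hf
    have e₁ := h₁ F₁ hF₁
    have e₂ := h₂ F₂ hF₂
    have i₁ := (hF₁.fderiv_apply (1, 0)).integrable_smul hw
    have i₂ := (hF₂.fderiv_apply (0, 1)).integrable_smul hw
    -- The left side is the pairing of `w` with `f - (∫ f) ζ`, `ζ` being the bump. This difference
    -- is `∂₁F₁ + ∂₂F₂`, since the slice integrals in the two parts of the decomposition cancel; the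
    -- derivatives then move onto `w`.
    have key : ∫ x in U, (w x - c) * f x =
        -(∫ x in U, F₁ x * q₁ x) - ∫ x in U, F₂ x * q₂ x := by
      have s1 : ∫ x in U, (w x - c) * f x = (∫ x in U, f x • w x) - (∫ x, f x) * c := by
        rw [← hf.setIntegral_eq, mul_comm, ← integral_const_mul, ← integral_sub
          (hf.integrable_smul hw) (hf.integrable.integrableOn.const_mul c)]
        refine integral_congr_ae (Eventually.of_forall fun x => ?_)
        simp only [smul_eq_mul]
        ring
      have s2 : (∫ x in U, f x • w x) - (∫ x, f x) * c =
          (∫ x in U, fderiv ℝ F₁ x (1, 0) • w x) + ∫ x in U, fderiv ℝ F₂ x (0, 1) • w x := by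
        rw [hc, ← integral_const_mul, ← integral_add i₁ i₂, ← integral_sub
          (hf.integrable_smul hw) (hζw.const_mul _)]
        refine integral_congr_ae (Eventually.of_forall fun x => ?_)
        simp only [smul_eq_mul, hd₁, hd₂]
        ring
      rw [s1, s2, e₁, e₂]
      simp only [smul_eq_mul]
      ring
    have bound : ∀ F q : ℝ × ℝ → ℝ, IsTest U F → MemLp q 2 (volume.restrict U) →
        ∫ x, F x ^ 2 ≤ max C₁ C₂ * ∫ x, f x ^ 2 →
        |∫ x in U, F x * q x| ≤
          √(max C₁ C₂) * √(∫ x in U, q x ^ 2) * √(∫ x in U, f x ^ 2) := by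
      intro F q hF hq hl
      refine (abs_integral_mul_le_sqrt hF.memLp hq).trans ?_
      rw [hF.setIntegral_sq_eq, hf.setIntegral_sq_eq]
      have := Real.sqrt_le_sqrt hl
      rw [Real.sqrt_mul hC0] at this
      calc _ ≤ (√(max C₁ C₂) * √(∫ x, f x ^ 2)) * √(∫ x in U, q x ^ 2) := by gcongr
        _ = _ := by ring
    have hf0 : 0 ≤ ∫ x, f x ^ 2 := integral_nonneg fun x => sq_nonneg _
    have k₁ := bound F₁ q₁ hF₁ hq₁
      (hl₁.trans (mul_le_mul_of_nonneg_right (le_max_left _ _) hf0))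
    have k₂ := bound F₂ q₂ hF₂ hq₂
      (hl₂.trans (mul_le_mul_of_nonneg_right (le_max_right _ _) hf0))
    change |∫ x in U, (w x - c) * f x| ≤ _
    rw [key]
    refine (abs_sub _ _).trans ?_
    rw [abs_neg]
    linarith
  · rw [mul_pow, Real.sq_sqrt hC0]
    have h3 : (√(∫ x in U, q₁ x ^ 2) + √(∫ x in U, q₂ x ^ 2)) ^ 2 ≤
        2 * ((∫ x in U, q₁ x ^ 2) + ∫ x in U, q₂ x ^ 2) := by
      nlinarith [Real.sq_sqrt hQ₁, Real.sq_sqrt hQ₂,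
        sq_nonneg (√(∫ x in U, q₁ x ^ 2) - √(∫ x in U, q₂ x ^ 2))]
    have := mul_le_mul_of_nonneg_left h3 hC0
    linarith

theorem setIntegral_norm_sq_complex {α : Type*} [MeasurableSpace α] {μ : Measure α} {f : α → ℂ}
    (hf : MemLp f 2 μ) :
    ∫ x, ‖f x‖ ^ 2 ∂μ = (∫ x, (f x).re ^ 2 ∂μ) + ∫ x, (f x).im ^ 2 ∂μ := by
  have h1 : MemLp (fun x => (f x).re) 2 μ := Complex.reCLM.comp_memLp' hf
  have h2 : MemLp (fun x => (f x).im) 2 μ := Complex.imCLM.comp_memLp' hf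
  rw [← integral_add h1.integrable_sq h2.integrable_sq]
  refine integral_congr_ae (Eventually.of_forall fun x => ?_)
  simp only [← Complex.normSq_eq_norm_sq, Complex.normSq_apply]
  ring

/-- The real inequality for the real and imaginary parts, whose two constants combine to a complex
one. -/
theorem exists_poincare_complex {α β a b T : ℝ} {γ : ℝ → ℝ} (hαβ : α < β) (hab : a < b)
    (hγ : Continuous γ) (hb : ∀ s ∈ Ioo α β, b ≤ γ s) (hT : ∀ s ∈ Ioo α β, γ s ≤ T) :
    ∃ C : ℝ, ∀ w q₁ q₂ : ℝ × ℝ → ℂ, MemLp w 2 (volume.restrict (subgraph α β a γ)) →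
      MemLp q₁ 2 (volume.restrict (subgraph α β a γ)) →
      MemLp q₂ 2 (volume.restrict (subgraph α β a γ)) →
      HasWeakDeriv (subgraph α β a γ) (1, 0) w q₁ → HasWeakDeriv (subgraph α β a γ) (0, 1) w q₂ →
      ∃ c : ℂ, ∫ x in subgraph α β a γ, ‖w x - c‖ ^ 2 ≤
        C * ((∫ x in subgraph α β a γ, ‖q₁ x‖ ^ 2) + ∫ x in subgraph α β a γ, ‖q₂ x‖ ^ 2) := by
  obtain ⟨C, hC⟩ := exists_poincare_real hαβ hab hγ hb hT
  refine ⟨C, fun w q₁ q₂ hw hq₁ hq₂ h₁ h₂ => ?_⟩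
  have hfin : IsFiniteMeasure (volume.restrict (subgraph α β a γ)) :=
    ⟨by simpa using measure_subgraph_lt_top hT⟩
  obtain ⟨c₁, k₁⟩ := hC _ _ _ (Complex.reCLM.comp_memLp' hw) (Complex.reCLM.comp_memLp' hq₁)
    (Complex.reCLM.comp_memLp' hq₂) (h₁.comp_clm hw hq₁ Complex.reCLM)
    (h₂.comp_clm hw hq₂ Complex.reCLM)
  obtain ⟨c₂, k₂⟩ := hC _ _ _ (Complex.imCLM.comp_memLp' hw) (Complex.imCLM.comp_memLp' hq₁)
    (Complex.imCLM.comp_memLp' hq₂) (h₁.comp_clm hw hq₁ Complex.imCLM)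
    (h₂.comp_clm hw hq₂ Complex.imCLM)
  refine ⟨⟨c₁, c₂⟩, ?_⟩
  have hwc : MemLp (fun x => w x - (⟨c₁, c₂⟩ : ℂ)) 2 (volume.restrict (subgraph α β a γ)) :=
    hw.sub (memLp_const _)
  rw [setIntegral_norm_sq_complex hwc, setIntegral_norm_sq_complex hq₁,
    setIntegral_norm_sq_complex hq₂]
  simp only [Function.comp_def, Complex.reCLM_apply, Complex.imCLM_apply, Complex.sub_re,
    Complex.sub_im] at k₁ k₂ ⊢
  linarith

/-! ### Change of coordinates in the plane -/

/-- Poincaré's inequality holds on `U`. -/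
def IsPoincare (U : Set Plane) : Prop :=
  ∃ C : ℝ, ∀ (v : Plane → ℂ) (p : Plane → CVec), MemLp v 2 (volume.restrict U) →
    MemLp p 2 (volume.restrict U) → HasWeakGrad U v p →
    ∃ c : ℂ, ∫ x in U, ‖v x - c‖ ^ 2 ≤ C * ∫ x in U, ‖p x‖ ^ 2

/-- The derivative in the direction `a` of a function with gradient `z`. -/
def dirDeriv (a : Plane) : CVec →L[ℝ] ℂ :=
  ∑ j, a j • ((EuclideanSpace.proj j : CVec →L[ℂ] ℂ).restrictScalars ℝ)

theorem dirDeriv_apply (a : Plane) (z : CVec) : dirDeriv a z = ∑ j, a j • z j := by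
  simp [dirDeriv]

theorem sum_smul_unitVec (a : Plane) : ∑ j, a j • unitVec j = a := by
  ext i
  fin_cases i <;> simp [unitVec]

theorem HasWeakGrad.hasWeakDeriv {U : Set Plane} {v : Plane → ℂ} {p : Plane → CVec}
    (h : HasWeakGrad U v p) (hv : MemLp v 2 (volume.restrict U))
    (hp : MemLp p 2 (volume.restrict U)) (a : Plane) :
    HasWeakDeriv U a v (fun x => dirDeriv a (p x)) := by
  intro φ hφ
  have e1 : ∀ x, fderiv ℝ φ x a • v x = ∑ j, a j • (fderiv ℝ φ x (unitVec j) • v x) := by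
    intro x
    conv_lhs => rw [← sum_smul_unitVec a]
    simp only [map_sum, map_smul, Finset.sum_smul, smul_assoc]
  have e2 : ∀ x, φ x • dirDeriv a (p x) = ∑ j, a j • (φ x • p x j) := by
    intro x
    simp only [dirDeriv_apply, Finset.smul_sum, smul_comm (φ x)]
  have i1 : ∀ j, IntegrableOn (fun x => a j • (fderiv ℝ φ x (unitVec j) • v x)) U := fun j =>
    ((hφ.fderiv_apply (unitVec j)).integrable_smul hv).smul (a j)
  have i2 : ∀ j, IntegrableOn (fun x => a j • (φ x • p x j)) U := fun j =>
    (hφ.integrable_smul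
      ((EuclideanSpace.proj (𝕜 := ℂ) j : CVec →L[ℂ] ℂ).comp_memLp' hp)).smul (a j)
  simp only [e1, e2]
  rw [integral_finsetSum _ fun j _ => i1 j, integral_finsetSum _ fun j _ => i2 j,
    ← Finset.sum_neg_distrib]
  refine Finset.sum_congr rfl fun j _ => ?_
  rw [integral_smul, integral_smul,
    h φ hφ.contDiff hφ.hasCompactSupport hφ.tsupport_subset j, smul_neg]

/-- Weak derivatives after a change of coordinates by a measure preserving affine map. -/
theorem HasWeakDeriv.comp_affine {S : Set (ℝ × ℝ)} (A : Plane ≃L[ℝ] ℝ × ℝ) (c : ℝ × ℝ)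
    {Ψ : Plane ≃ₜ ℝ × ℝ} (hΨ : ∀ y, Ψ y = A y + c)
    (hr : MeasurePreserving Ψ.toMeasurableEquiv (volume.restrict (Ψ ⁻¹' S)) (volume.restrict S))
    {v q : Plane → ℂ} {b : ℝ × ℝ} (h : HasWeakDeriv (Ψ ⁻¹' S) (A.symm b) v q) :
    HasWeakDeriv S b (v ∘ Ψ.symm) (q ∘ Ψ.symm) := by
  intro φ hφ
  have hfun : (Ψ : Plane → ℝ × ℝ) = fun y => A y + c := funext hΨ
  have hd : ∀ y, HasFDerivAt Ψ (A : Plane →L[ℝ] ℝ × ℝ) y := fun y => by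
    rw [hfun]
    exact A.hasFDerivAt.add_const c
  have hcd : ContDiff ℝ ∞ Ψ := by
    rw [hfun]
    exact A.contDiff.add contDiff_const
  have hts : tsupport (φ ∘ Ψ) = Ψ ⁻¹' tsupport φ := tsupport_comp_eq_preimage φ Ψ
  -- The test function is pulled back; by the chain rule its derivative along `A.symm b` is that of
  -- `φ` along `b`.
  have hφ' : IsTest (Ψ ⁻¹' S) (φ ∘ Ψ) :=
    ⟨hφ.contDiff.comp hcd, hφ.hasCompactSupport.comp_homeomorph Ψ, by
      rw [hts]
      exact preimage_mono hφ.tsupport_subset⟩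
  have e := h _ hφ'
  rw [← hr.integral_comp', ← hr.integral_comp']
  refine Eq.trans ?_ (e.trans ?_)
  · refine integral_congr_ae (Eventually.of_forall fun y => ?_)
    have hc : fderiv ℝ (φ ∘ Ψ) y = (fderiv ℝ φ (Ψ y)).comp (A : Plane →L[ℝ] ℝ × ℝ) :=
      (((hφ.contDiff.differentiable (by simp) (Ψ y)).hasFDerivAt).comp y (hd y)).fderiv
    simp [hc]
  · simp

/-- Poincaré's inequality on a region below a graph, in Cartesian coordinates. -/
theorem isPoincare_preimage_subgraph {α β a b T : ℝ} {γ : ℝ → ℝ} (hαβ : α < β) (hab : a < b)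
    (hγ : Continuous γ) (hb : ∀ s ∈ Ioo α β, b ≤ γ s) (hT : ∀ s ∈ Ioo α β, γ s ≤ T)
    (A : Plane ≃L[ℝ] ℝ × ℝ) (hA : MeasurePreserving A) (c : ℝ × ℝ) :
    IsPoincare {y | A y + c ∈ subgraph α β a γ} := by
  obtain ⟨C, hC⟩ := exists_poincare_complex hαβ hab hγ hb hT
  let Ψ : Plane ≃ₜ ℝ × ℝ := A.toHomeomorph.trans (Homeomorph.addRight c)
  set S := subgraph α β a γ with hS
  have hSm : MeasurableSet S := (isOpen_subgraph hγ).measurableSet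
  have hΨ : ∀ y, Ψ y = A y + c := fun y => rfl
  have hmp : MeasurePreserving Ψ.toMeasurableEquiv volume volume :=
    (measurePreserving_add_right volume c).comp hA
  have hr : MeasurePreserving Ψ.toMeasurableEquiv (volume.restrict (Ψ ⁻¹' S))
      (volume.restrict S) := hmp.restrict_preimage hSm
  have hr' : MeasurePreserving Ψ.symm (volume.restrict S) (volume.restrict (Ψ ⁻¹' S)) :=
    hr.symm
  change IsPoincare (Ψ ⁻¹' S)
  obtain ⟨B, hB0, hB⟩ : ∃ B : ℝ, 0 ≤ B ∧ ∀ z : CVec,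
      ‖dirDeriv (A.symm (1, 0)) z‖ ^ 2 + ‖dirDeriv (A.symm (0, 1)) z‖ ^ 2 ≤ B * ‖z‖ ^ 2 := by
    refine ⟨‖dirDeriv (A.symm (1, 0))‖ ^ 2 + ‖dirDeriv (A.symm (0, 1))‖ ^ 2, by positivity,
      fun z => ?_⟩
    rw [add_mul, ← mul_pow, ← mul_pow]
    gcongr <;> exact ContinuousLinearMap.le_opNorm _ _
  -- Nothing says that `C` is nonnegative, and it has to multiply an upper bound of the gradient
  -- term.
  refine ⟨max C 0 * B, fun v p hv hp h => ?_⟩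
  have hd : ∀ d : ℝ × ℝ, MemLp (fun x => dirDeriv (A.symm d) (p x)) 2
      (volume.restrict (Ψ ⁻¹' S)) := fun d => (dirDeriv (A.symm d)).comp_memLp' hp
  obtain ⟨m, hm⟩ := hC _ _ _ (hv.comp_measurePreserving hr')
    ((hd (1, 0)).comp_measurePreserving hr') ((hd (0, 1)).comp_measurePreserving hr')
    ((h.hasWeakDeriv hv hp _).comp_affine A c hΨ hr) ((h.hasWeakDeriv hv hp _).comp_affine A c hΨ hr)
  refine ⟨m, ?_⟩
  rw [← hr.integral_comp', ← hr.integral_comp', ← hr.integral_comp'] at hm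
  simp only [Homeomorph.toMeasurableEquiv_coe, Function.comp_apply,
    Homeomorph.symm_apply_apply] at hm
  refine hm.trans ?_
  rw [← integral_add (hd _).norm.integrable_sq (hd _).norm.integrable_sq]
  have hle : (∫ x in Ψ ⁻¹' S, (‖dirDeriv (A.symm (1, 0)) (p x)‖ ^ 2 +
      ‖dirDeriv (A.symm (0, 1)) (p x)‖ ^ 2)) ≤ B * ∫ x in Ψ ⁻¹' S, ‖p x‖ ^ 2 := by
    rw [← integral_const_mul]
    exact integral_mono ((hd _).norm.integrable_sq.add (hd _).norm.integrable_sq)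
      (hp.norm.integrable_sq.const_mul _) fun x => hB (p x)
  have h0 : 0 ≤ ∫ x in Ψ ⁻¹' S, (‖dirDeriv (A.symm (1, 0)) (p x)‖ ^ 2 +
      ‖dirDeriv (A.symm (0, 1)) (p x)‖ ^ 2) := integral_nonneg fun x => by positivity
  calc _ ≤ max C 0 * ∫ x in Ψ ⁻¹' S, (‖dirDeriv (A.symm (1, 0)) (p x)‖ ^ 2 +
      ‖dirDeriv (A.symm (0, 1)) (p x)‖ ^ 2) := by
        gcongr
        exact le_max_left _ _
    _ ≤ max C 0 * (B * ∫ x in Ψ ⁻¹' S, ‖p x‖ ^ 2) := by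
        gcongr
    _ = _ := by ring

/-- The Cartesian coordinates in the plane. -/
def coords : Plane ≃L[ℝ] ℝ × ℝ :=
  (EuclideanSpace.equiv (Fin 2) ℝ).trans (ContinuousLinearEquiv.finTwoArrow ℝ ℝ)

theorem measurePreserving_coords : MeasurePreserving coords :=
  (volume_preserving_finTwoArrow ℝ).comp (PiLp.volume_preserving_ofLp (Fin 2))

/-- An affine isometry is a linear isometry, which preserves Lebesgue measure, followed by a
translation. -/
theorem isPoincare_of_affineIsometry {α β a b T : ℝ} {γ : ℝ → ℝ} (hαβ : α < β) (hab : a < b)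
    (hγ : Continuous γ) (hb : ∀ s ∈ Ioo α β, b ≤ γ s) (hT : ∀ s ∈ Ioo α β, γ s ≤ T)
    (e : Plane ≃ᵃⁱ[ℝ] Plane) :
    IsPoincare {y | (e y 0, e y 1) ∈ subgraph α β a γ} := by
  have h := isPoincare_preimage_subgraph hαβ hab hγ hb hT
    (e.linearIsometryEquiv.toContinuousLinearEquiv.trans coords)
    (measurePreserving_coords.comp e.linearIsometryEquiv.measurePreserving) (coords (e 0))
  convert h using 4 with y
  have he : e y = e.linearIsometryEquiv y + e 0 := by
    simpa using e.map_vadd 0 y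
  change coords (e y) = coords (e.linearIsometryEquiv y) + coords (e 0)
  rw [he, map_add]

/-! ### Gluing Poincaré's inequality over overlapping open sets -/

theorem HasWeakGrad.mono {U V : Set Plane} {v : Plane → ℂ} {p : Plane → CVec}
    (h : HasWeakGrad V v p) (hUV : U ⊆ V) : HasWeakGrad U v p := by
  intro φ h1 h2 h3 j
  have hφ : IsTest U φ := ⟨h1, h2, h3⟩
  have hV := h φ h1 h2 (h3.trans hUV) j
  have e : ∀ {W : Set Plane}, IsTest W φ →
      (∫ x in W, fderiv ℝ φ x (unitVec j) • v x = ∫ x, fderiv ℝ φ x (unitVec j) • v x) ∧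
      ∫ x in W, φ x • p x j = ∫ x, φ x • p x j := fun hW =>
    ⟨setIntegral_eq_integral_of_forall_compl_eq_zero fun x hx => by
        rw [(hW.fderiv_apply (unitVec j)).eq_zero hx, zero_smul],
      setIntegral_eq_integral_of_forall_compl_eq_zero fun x hx => by rw [hW.eq_zero hx, zero_smul]⟩
  have hφV : IsTest V φ := ⟨h1, h2, h3.trans hUV⟩
  rw [(e hφ).1, (e hφ).2, ← (e hφV).1, ← (e hφV).2, hV]

theorem IsPoincare.exists_nonneg {U : Set Plane} (h : IsPoincare U) :
    ∃ C : ℝ, 0 ≤ C ∧ ∀ (v : Plane → ℂ) (p : Plane → CVec), MemLp v 2 (volume.restrict U) →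
    MemLp p 2 (volume.restrict U) → HasWeakGrad U v p →
    ∃ c : ℂ, ∫ x in U, ‖v x - c‖ ^ 2 ≤ C * ∫ x in U, ‖p x‖ ^ 2 := by
  obtain ⟨C, hC⟩ := h
  refine ⟨max C 0, le_max_right _ _, fun v p hv hp hvp => ?_⟩
  obtain ⟨c, hc⟩ := hC v p hv hp hvp
  refine ⟨c, hc.trans ?_⟩
  gcongr
  exact le_max_left _ _

theorem norm_sq_le_two_mul {F : Type*} [SeminormedAddCommGroup F] (a b c : F) :
    ‖a - c‖ ^ 2 ≤ 2 * ‖a - b‖ ^ 2 + 2 * ‖b - c‖ ^ 2 := by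
  have h := norm_sub_le_norm_sub_add_norm_sub a b c
  nlinarith [sq_nonneg (‖a - b‖ - ‖b - c‖), norm_nonneg (a - c)]

/-- The overlap is open and non-empty, hence of positive measure `m`. There `v` is close to both
constants, which gives `‖c₂ - c₁‖² ≤ 2 (C₁ + C₂) / m * P`, where `P` is the squared norm of the
gradient on the union. So `c₁` may replace `c₂` on `U₂`, at the cost of a factor `2` and of `2 |U₂|
‖c₂ - c₁‖²`. -/
theorem IsPoincare.union {U₁ U₂ : Set Plane} (h₁ : IsPoincare U₁) (h₂ : IsPoincare U₂)
    (o₁ : IsOpen U₁) (o₂ : IsOpen U₂) (f₁ : volume U₁ < ⊤) (f₂ : volume U₂ < ⊤)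
    (hne : (U₁ ∩ U₂).Nonempty) : IsPoincare (U₁ ∪ U₂) := by
  obtain ⟨C₁, hC₁0, hC₁⟩ := h₁.exists_nonneg
  obtain ⟨C₂, hC₂0, hC₂⟩ := h₂.exists_nonneg
  have hI : 0 < volume.real (U₁ ∩ U₂) := by
    rw [measureReal_def, ENNReal.toReal_pos_iff]
    exact ⟨(o₁.inter o₂).measure_pos _ hne, (measure_mono inter_subset_left).trans_lt f₁⟩
  have : IsFiniteMeasure (volume.restrict U₁) := ⟨by simpa using f₁⟩
  have : IsFiniteMeasure (volume.restrict U₂) := ⟨by simpa using f₂⟩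
  have : IsFiniteMeasure (volume.restrict (U₁ ∪ U₂)) :=
    ⟨by simpa using measure_union_lt_top f₁ f₂⟩
  set m := volume.real (U₁ ∩ U₂)
  refine ⟨C₁ + 2 * C₂ + 2 * volume.real U₂ * (2 * (C₁ + C₂) / m), fun v p hv hp h => ?_⟩
  have hv₁ := hv.mono_measure (Measure.restrict_mono (subset_union_left (s := U₁) (t := U₂)) le_rfl)
  have hv₂ := hv.mono_measure (Measure.restrict_mono (subset_union_right (s := U₁) (t := U₂)) le_rfl)
  have hp₁ := hp.mono_measure (Measure.restrict_mono (subset_union_left (s := U₁) (t := U₂)) le_rfl)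
  have hp₂ := hp.mono_measure (Measure.restrict_mono (subset_union_right (s := U₁) (t := U₂)) le_rfl)
  obtain ⟨c₁, k₁⟩ := hC₁ v p hv₁ hp₁ (h.mono subset_union_left)
  obtain ⟨c₂, k₂⟩ := hC₂ v p hv₂ hp₂ (h.mono subset_union_right)
  set P := ∫ x in U₁ ∪ U₂, ‖p x‖ ^ 2
  have hpi := hp.norm.integrable_sq
  have l₁ : ∫ x in U₁, ‖p x‖ ^ 2 ≤ P := setIntegral_mono_set hpi
    (Eventually.of_forall fun x => sq_nonneg _) subset_union_left.eventuallyLE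
  have l₂ : ∫ x in U₂, ‖p x‖ ^ 2 ≤ P := setIntegral_mono_set hpi
    (Eventually.of_forall fun x => sq_nonneg _) subset_union_right.eventuallyLE
  replace k₁ := k₁.trans (mul_le_mul_of_nonneg_left l₁ hC₁0)
  replace k₂ := k₂.trans (mul_le_mul_of_nonneg_left l₂ hC₂0)
  have i : ∀ c, IntegrableOn (fun x => ‖v x - c‖ ^ 2) (U₁ ∪ U₂) := fun c =>
    (hv.sub (memLp_const c)).norm.integrable_sq
  have i₁ : ∀ c, IntegrableOn (fun x => ‖v x - c‖ ^ 2) U₁ := fun c =>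
    (i c).mono_set subset_union_left
  have i₂ : ∀ c, IntegrableOn (fun x => ‖v x - c‖ ^ 2) U₂ := fun c =>
    (i c).mono_set subset_union_right
  have hc : ‖c₂ - c₁‖ ^ 2 ≤ 2 * (C₁ + C₂) / m * P := by
    have e1 : ∫ x in U₁ ∩ U₂, ‖v x - c₁‖ ^ 2 ≤ C₁ * P := (setIntegral_mono_set (i₁ c₁)
      (Eventually.of_forall fun x => sq_nonneg _) inter_subset_left.eventuallyLE).trans k₁
    have e2 : ∫ x in U₁ ∩ U₂, ‖v x - c₂‖ ^ 2 ≤ C₂ * P := (setIntegral_mono_set (i₂ c₂)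
      (Eventually.of_forall fun x => sq_nonneg _) inter_subset_right.eventuallyLE).trans k₂
    have j1 := ((i₁ c₁).mono_set (inter_subset_left (t := U₂))).const_mul 2
    have j2 := ((i₂ c₂).mono_set (inter_subset_right (s := U₁))).const_mul 2
    have fin : volume (U₁ ∩ U₂) ≠ ⊤ := ((measure_mono inter_subset_left).trans_lt f₁).ne
    have e3 : ∫ x in U₁ ∩ U₂, ‖c₂ - c₁‖ ^ 2 ≤
        ∫ x in U₁ ∩ U₂, (2 * ‖v x - c₂‖ ^ 2 + 2 * ‖v x - c₁‖ ^ 2) := by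
      refine integral_mono (integrableOn_const fin) (j2.add j1) fun x => ?_
      have := norm_sq_le_two_mul c₂ (v x) c₁
      rwa [norm_sub_rev c₂ (v x)] at this
    rw [integral_add j2 j1, integral_const_mul, integral_const_mul, setIntegral_const,
      smul_eq_mul] at e3
    rw [div_mul_eq_mul_div, le_div_iff₀ hI]
    linarith
  have hU₂ : ∫ x in U₂, ‖v x - c₁‖ ^ 2 ≤
      2 * (C₂ * P) + 2 * volume.real U₂ * (2 * (C₁ + C₂) / m * P) := by
    have e3 : ∫ x in U₂, ‖v x - c₁‖ ^ 2 ≤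
        ∫ x in U₂, (2 * ‖v x - c₂‖ ^ 2 + 2 * ‖c₂ - c₁‖ ^ 2) :=
      integral_mono (i₂ c₁) (((i₂ c₂).const_mul 2).add (integrable_const _)) fun x =>
        norm_sq_le_two_mul (v x) c₂ c₁
    rw [integral_add ((i₂ c₂).const_mul 2) (integrable_const _), integral_const_mul,
      setIntegral_const, smul_eq_mul] at e3
    have := mul_le_mul_of_nonneg_left hc (measureReal_nonneg (μ := volume) (s := U₂))
    linarith
  refine ⟨c₁, ?_⟩
  have hsplit : ∫ x in U₁ ∪ U₂, ‖v x - c₁‖ ^ 2 ≤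
      (∫ x in U₁, ‖v x - c₁‖ ^ 2) + ∫ x in U₂, ‖v x - c₁‖ ^ 2 := by
    rw [← union_sdiff_self, setIntegral_union disjoint_sdiff_right
      (o₂.measurableSet.diff o₁.measurableSet) (i₁ c₁) ((i₂ c₁).mono_set sdiff_subset)]
    gcongr
    · exact Eventually.of_forall fun x => sq_nonneg _
    · exact i₂ c₁
    · exact sdiff_subset
  linarith

/-- A connected finite union of non-empty open sets satisfying Poincaré's inequality satisfies
Poincaré's inequality. -/
theorem isPoincare_biUnion {ι : Type*} [DecidableEq ι] (I : Finset ι) (U : ι → Set Plane)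
    (hI : I.Nonempty) (ho : ∀ i, IsOpen (U i)) (hf : ∀ i, volume (U i) < ⊤)
    (hP : ∀ i, IsPoincare (U i)) (hne : ∀ i, (U i).Nonempty)
    (hc : IsPreconnected (⋃ i ∈ I, U i)) : IsPoincare (⋃ i ∈ I, U i) := by
  classical
  let 𝒥 := I.powerset.filter fun J => J.Nonempty ∧ IsPoincare (⋃ i ∈ J, U i)
  have h𝒥 : 𝒥.Nonempty := by
    obtain ⟨i, hi⟩ := hI
    refine ⟨{i}, Finset.mem_filter.2 ⟨?_, Finset.singleton_nonempty i, ?_⟩⟩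
    · simpa using hi
    · simpa using hP i
  -- Choose a largest subfamily whose union satisfies the inequality. If it is not all of `I`,
  -- connectedness makes some remaining piece meet its union, and adding that piece contradicts
  -- maximality.
  obtain ⟨J, hJ, hmax⟩ := 𝒥.exists_max_image Finset.card h𝒥
  obtain ⟨hJI, ⟨j, hj⟩, hJP⟩ := Finset.mem_filter.1 hJ
  rw [Finset.mem_powerset] at hJI
  by_cases hIJ : I ⊆ J
  · rwa [Finset.Subset.antisymm hIJ hJI]
  exfalso
  obtain ⟨i, hi, hiJ⟩ := Finset.not_subset.1 hIJ
  have hsub : ∀ k ∈ I, U k ⊆ ⋃ i ∈ I, U i := fun k hk => subset_biUnion_of_mem (u := U) hk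
  obtain ⟨x, -, hx1, hx2⟩ := hc (⋃ i ∈ J, U i) (⋃ i ∈ I \ J, U i)
    (isOpen_biUnion fun i _ => ho i) (isOpen_biUnion fun i _ => ho i)
    (by
      intro x hx
      simp only [mem_iUnion, exists_prop] at hx
      obtain ⟨k, hk, hxk⟩ := hx
      by_cases hkJ : k ∈ J
      · exact Or.inl (mem_biUnion hkJ hxk)
      · exact Or.inr (mem_biUnion (Finset.mem_sdiff.2 ⟨hk, hkJ⟩) hxk))
    (by
      obtain ⟨y, hy⟩ := hne j
      exact ⟨y, hsub j (hJI hj) hy, mem_biUnion hj hy⟩)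
    (by
      obtain ⟨y, hy⟩ := hne i
      exact ⟨y, hsub i hi hy, mem_biUnion (Finset.mem_sdiff.2 ⟨hi, hiJ⟩) hy⟩)
  simp only [mem_iUnion, exists_prop] at hx2
  obtain ⟨k, hk, hxk⟩ := hx2
  obtain ⟨hkI, hkJ⟩ := Finset.mem_sdiff.1 hk
  have hfJ : volume (⋃ i ∈ J, U i) < ⊤ := by
    refine (measure_biUnion_finset_le J U).trans_lt ?_
    exact ENNReal.sum_lt_top.2 fun i _ => hf i
  have hnew : insert k J ∈ 𝒥 := by
    refine Finset.mem_filter.2 ⟨?_, Finset.insert_nonempty _ _, ?_⟩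
    · exact Finset.mem_powerset.2 (Finset.insert_subset hkI hJI)
    · rw [Finset.set_biUnion_insert]
      exact (hP k).union hJP (ho k) (isOpen_biUnion fun i _ => ho i) (hf k) hfJ ⟨x, hxk, hx1⟩
  have := hmax _ hnew
  rw [Finset.card_insert_of_notMem hkJ] at this
  omega

/-! ### Local structure of `Y*` at the points of its closure -/

theorem continuous_coord (j : Fin 2) : Continuous fun y : Plane => y j := by fun_prop

theorem dist_lt_of_abs_coord_sub {x y : Plane} {r : ℝ} (h0 : |x 0 - y 0| < r / 2)
    (h1 : |x 1 - y 1| < r / 2) : dist x y < r := by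
  have hr : 0 < r := by linarith [abs_nonneg (x 0 - y 0)]
  rw [EuclideanSpace.dist_eq, Real.sqrt_lt' hr, Fin.sum_univ_two, Real.dist_eq, Real.dist_eq]
  nlinarith [abs_nonneg (x 0 - y 0), abs_nonneg (x 1 - y 1)]

theorem isOpen_openCell : IsOpen openCell := by
  have : openCell = ⋂ j, (fun y : Plane => y j) ⁻¹' Ioo (-1 / 2 : ℝ) (1 / 2) := by
    ext y
    simp [openCell]
  rw [this]
  exact isOpen_iInter_of_finite fun j => isOpen_Ioo.preimage (continuous_coord j)

theorem closure_openCell_subset : closure openCell ⊆ {y | ∀ j, y j ∈ Icc (-1 / 2 : ℝ) (1 / 2)} := by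
  have : {y : Plane | ∀ j, y j ∈ Icc (-1 / 2 : ℝ) (1 / 2)} =
      ⋂ j, (fun y : Plane => y j) ⁻¹' Icc (-1 / 2 : ℝ) (1 / 2) := by
    ext y
    simp
  rw [this]
  refine closure_minimal ?_ (isClosed_iInter fun j => isClosed_Icc.preimage (continuous_coord j))
  intro y hy
  simpa using fun j => Ioo_subset_Icc_self (hy j)

theorem isBounded_openCell : Bornology.IsBounded openCell := by
  refine (Metric.isBounded_ball (x := (0 : Plane)) (r := 2)).subset fun y hy => ?_
  rw [Metric.mem_ball]
  have h0 := hy 0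
  have h1 := hy 1
  refine dist_lt_of_abs_coord_sub ?_ ?_
  · rw [PiLp.zero_apply, sub_zero, abs_lt]
    constructor <;> linarith [h0.1, h0.2]
  · rw [PiLp.zero_apply, sub_zero, abs_lt]
    constructor <;> linarith [h1.1, h1.2]

theorem isBounded_YStar (D : Set Plane) : Bornology.IsBounded (YStar D) :=
  isBounded_openCell.subset sdiff_subset

/-- Near a boundary point, the closure of a `C²` domain is the epigraph of its boundary graph. -/
theorem mem_closure_iff_of_graph {D : Set Plane} {x : Plane} {e : Plane ≃ᵃⁱ[ℝ] Plane} {γ : ℝ → ℝ}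
    {r : ℝ} (hγ : Continuous γ)
    (h : ∀ y ∈ Metric.ball x r, y ∈ D ↔ γ (e y 0) < e y 1) {y : Plane}
    (hy : y ∈ Metric.ball x r) : y ∈ closure D ↔ γ (e y 0) ≤ e y 1 := by
  have he0 : Continuous fun y => e y 0 := (continuous_coord 0).comp e.continuous
  have he1 : Continuous fun y => e y 1 := (continuous_coord 1).comp e.continuous
  constructor
  · intro hyD
    by_contra! hlt
    -- The part of the ball strictly below the graph is open and misses `D`.
    have ho : IsOpen ({z | e z 1 < γ (e z 0)} ∩ Metric.ball x r) :=
      (isOpen_lt he1 (hγ.comp he0)).inter Metric.isOpen_ball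
    obtain ⟨z, ⟨hz1, hz2⟩, hz3⟩ := mem_closure_iff.1 hyD _ ho ⟨hlt, hy⟩
    exact lt_asymm hz1 ((h z hz2).1 hz3)
  · intro hle
    -- Moving `y` upwards in the graph coordinates puts it strictly above the graph, so `y` is a
    -- limit of points of `D`.
    let z : ℝ → Plane := fun t => e.symm (e y + t • unitVec 1)
    have hz : Continuous z := e.symm.continuous.comp (by fun_prop)
    have hz0 : z 0 = y := by simp [z]
    have hlim : Tendsto z (𝓝[>] 0) (𝓝 y) := by
      have := hz.tendsto 0
      rw [hz0] at this
      exact this.mono_left nhdsWithin_le_nhds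
    refine mem_closure_of_tendsto hlim ?_
    filter_upwards [hlim (Metric.isOpen_ball.mem_nhds hy), self_mem_nhdsWithin] with t ht ht0
    rw [h _ ht]
    have ht0' : 0 < t := ht0
    simp only [z, AffineIsometryEquiv.apply_symm_apply, PiLp.add_apply, PiLp.smul_apply, unitVec,
      PiLp.single_apply, smul_eq_mul]
    simp only [Fin.isValue, zero_ne_one, if_false, if_true, mul_zero, add_zero, mul_one]
    linarith

/-- `U` is an open subset of `s` that satisfies Poincaré's inequality and coincides with `s` on a
neighbourhood of `x`. -/
structure IsPoincareNhd (s : Set Plane) (x : Plane) (N U : Set Plane) : Prop where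
  isOpen_nhd : IsOpen N
  mem : x ∈ N
  isOpen : IsOpen U
  subset : U ⊆ s
  isPoincare : IsPoincare U
  inter_subset : N ∩ s ⊆ U

/-- Locally `D` lies above a graph and its closure on or above it, so `Y*` is exactly the part
strictly below: a region of the kind treated above, in rotated coordinates. -/
theorem exists_isPoincareNhd_of_mem_frontier {D : Set Plane} (hD : IsInclusion D) {x : Plane}
    (hx : x ∈ frontier D) : ∃ N U, IsPoincareNhd (YStar D) x N U := by
  obtain ⟨e, γ, r₀, hγ2, hr₀, hg⟩ := hD.isC2Domain.boundary x hx
  have hγ := hγ2.continuous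
  have hxc : x ∈ openCell := hD.closure_subset (frontier_subset_closure hx)
  obtain ⟨r₁, hr₁, hball⟩ := Metric.isOpen_iff.1 isOpen_openCell x hxc
  set r := min r₀ r₁
  have hr : 0 < r := lt_min hr₀ hr₁
  have hg' : ∀ y ∈ Metric.ball x r, y ∈ closure D ↔ γ (e y 0) ≤ e y 1 := fun y hy =>
    mem_closure_iff_of_graph hγ hg (Metric.ball_subset_ball (min_le_left _ _) hy)
  have hcell : Metric.ball x r ⊆ openCell :=
    (Metric.ball_subset_ball (min_le_right _ _)).trans hball
  have hxr : x ∈ Metric.ball x r₀ := Metric.mem_ball_self hr₀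
  have hxγ : γ (e x 0) = e x 1 := by
    refine le_antisymm ((hg' x (Metric.mem_ball_self hr)).1 (frontier_subset_closure hx)) ?_
    by_contra! hlt
    rw [hD.isC2Domain.isOpen.frontier_eq] at hx
    exact hx.2 ((hg x hxr).2 hlt)
  -- On the chosen interval the graph varies by less than `r / 8` about the height of `x`. With the
  -- bottom at depth `r / 4`, a strip of height `r / 8` below the graph remains, as the inequality
  -- for subgraphs requires, and the box stays in the ball of radius `r`.
  obtain ⟨δ₀, hδ₀, hδγ⟩ := Metric.continuous_iff.1 hγ (e x 0) (r / 8) (by positivity)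
  set δ := min δ₀ (r / 4)
  have hδ : 0 < δ := lt_min hδ₀ (by positivity)
  have hclose : ∀ s ∈ Ioo (e x 0 - δ) (e x 0 + δ), |γ s - e x 1| < r / 8 := by
    intro s hs
    rw [← hxγ, ← Real.dist_eq]
    refine hδγ s (lt_of_lt_of_le ?_ (min_le_left δ₀ (r / 4)))
    rw [Real.dist_eq, abs_lt]
    constructor <;> linarith [hs.1, hs.2]
  have hδr : δ ≤ r / 4 := min_le_right _ _
  have he0 : Continuous fun y => e y 0 := (continuous_coord 0).comp e.continuous
  have he1 : Continuous fun y => e y 1 := (continuous_coord 1).comp e.continuous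
  have hin : ∀ y, e y 0 ∈ Ioo (e x 0 - δ) (e x 0 + δ) → |e y 1 - e x 1| < r / 2 →
      y ∈ Metric.ball x r := by
    intro y h0 h1
    rw [Metric.mem_ball, ← e.dist_map]
    refine dist_lt_of_abs_coord_sub ?_ h1
    rw [abs_lt]
    constructor <;> linarith [h0.1, h0.2]
  refine ⟨{y | e y 0 ∈ Ioo (e x 0 - δ) (e x 0 + δ) ∧ e y 1 ∈ Ioo (e x 1 - r / 4) (e x 1 + r / 4)},
    {y | (e y 0, e y 1) ∈ subgraph (e x 0 - δ) (e x 0 + δ) (e x 1 - r / 4) γ},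
    (isOpen_Ioo.preimage he0).inter (isOpen_Ioo.preimage he1), ⟨⟨by linarith, by linarith⟩,
      ⟨by linarith, by linarith⟩⟩, (isOpen_subgraph hγ).preimage (he0.prodMk he1), ?_, ?_, ?_⟩
  · rintro y ⟨h0, h1⟩
    have hc := abs_lt.1 (hclose _ h0)
    have hy : y ∈ Metric.ball x r := hin y h0 (by
      simp only at h1
      rw [abs_lt]
      constructor <;> linarith [h1.1, h1.2])
    exact ⟨hcell hy, fun hyD => not_lt.2 ((hg' y hy).1 hyD) h1.2⟩
  · refine isPoincare_of_affineIsometry (b := e x 1 - r / 8) (T := e x 1 + r / 8) (by linarith)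
      (by linarith) hγ (fun s hs => ?_) (fun s hs => ?_) e
    · linarith [(abs_lt.1 (hclose s hs)).1]
    · linarith [(abs_lt.1 (hclose s hs)).2]
  · rintro y ⟨⟨h0, h1⟩, -, hyD⟩
    have hy : y ∈ Metric.ball x r := hin y h0 (by
      rw [abs_lt]
      constructor <;> linarith [h1.1, h1.2])
    rw [hg' y hy, not_le] at hyD
    exact ⟨h0, h1.1, hyD⟩

/-- Away from the closure of `D` a small box cut with the open cell is a rectangle, also at edges
and corners, and a rectangle is the region under a constant graph. -/
theorem exists_isPoincareNhd_of_notMem_closure {D : Set Plane} {x : Plane}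
    (hx : x ∈ closure openCell) (hxD : x ∉ closure D) :
    ∃ N U, IsPoincareNhd (YStar D) x N U := by
  have hxI := closure_openCell_subset hx
  obtain ⟨r, hr, hball⟩ := Metric.isOpen_iff.1 isClosed_closure.isOpen_compl x hxD
  have h0 := hxI 0
  have h1 := hxI 1
  let R : Fin 2 → Set ℝ := fun j => Ioo (max (x j - r / 2) (-1 / 2)) (min (x j + r / 2) (1 / 2))
  have hR : ∀ j t, t ∈ R j ↔ |t - x j| < r / 2 ∧ t ∈ Ioo (-1 / 2 : ℝ) (1 / 2) := by
    intro j t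
    simp only [R, mem_Ioo, max_lt_iff, lt_min_iff, abs_lt]
    constructor
    · rintro ⟨⟨a1, a2⟩, a3, a4⟩
      exact ⟨⟨by linarith, by linarith⟩, a2, a4⟩
    · rintro ⟨⟨a1, a2⟩, a3, a4⟩
      exact ⟨⟨by linarith, a3⟩, by linarith, a4⟩
  have hne : ∀ j, max (x j - r / 2) (-1 / 2) < min (x j + r / 2) (1 / 2) := by
    intro j
    have hj := hxI j
    rw [max_lt_iff, lt_min_iff, lt_min_iff]
    exact ⟨⟨by linarith, by linarith [hj.2]⟩, by linarith [hj.1], by norm_num⟩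
  refine ⟨{y | |y 0 - x 0| < r / 2 ∧ |y 1 - x 1| < r / 2}, {y | y 0 ∈ R 0 ∧ y 1 ∈ R 1},
    (isOpen_lt (f := fun y : Plane => |y 0 - x 0|) (by fun_prop) continuous_const).inter
      (isOpen_lt (f := fun y : Plane => |y 1 - x 1|) (by fun_prop) continuous_const),
    by simpa using hr, (isOpen_Ioo.preimage (continuous_coord 0)).inter
      (isOpen_Ioo.preimage (continuous_coord 1)), ?_, ?_, ?_⟩
  · rintro y ⟨k0, k1⟩
    rw [hR] at k0 k1
    refine ⟨fun j => ?_, hball (dist_lt_of_abs_coord_sub k0.1 k1.1)⟩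
    fin_cases j
    · exact k0.2
    · exact k1.2
  · exact isPoincare_of_affineIsometry (γ := fun _ => min (x 1 + r / 2) (1 / 2)) (hne 0) (hne 1)
      continuous_const (fun _ _ => le_rfl) (fun _ _ => le_rfl) (AffineIsometryEquiv.refl ℝ Plane)
  · rintro y ⟨⟨k0, k1⟩, hy, -⟩
    exact ⟨(hR 0 _).2 ⟨k0, hy 0⟩, (hR 1 _).2 ⟨k1, hy 1⟩⟩

/-- A point in both closures lies on the boundary of `D`, since `D` is open and disjoint from `Y*`.
-/
theorem exists_isPoincareNhd {D : Set Plane} (hD : IsInclusion D) {x : Plane}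
    (hx : x ∈ closure (YStar D)) : ∃ N U, IsPoincareNhd (YStar D) x N U := by
  by_cases hxD : x ∈ closure D
  · refine exists_isPoincareNhd_of_mem_frontier hD ?_
    rw [hD.isC2Domain.isOpen.frontier_eq]
    refine ⟨hxD, fun h => ?_⟩
    obtain ⟨z, hz1, hz2⟩ := mem_closure_iff.1 hx D hD.isC2Domain.isOpen h
    exact hz2.2 (subset_closure hz1)
  · exact exists_isPoincareNhd_of_notMem_closure (closure_mono sdiff_subset hx) hxD

/-- Compactness of the closure of `Y*` leaves finitely many of the local regions. Their union is
exactly `Y*`, and each is non-empty because its centre lies in the closure. -/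
theorem isPoincare_YStar {D : Set Plane} (hD : IsInclusion D) : IsPoincare (YStar D) := by
  classical
  have hK : IsCompact (closure (YStar D)) := (isBounded_YStar D).isCompact_closure
  choose N U h using fun x : closure (YStar D) => exists_isPoincareNhd hD x.2
  obtain ⟨I, hI⟩ := hK.elim_finite_subcover N (fun x => (h x).isOpen_nhd)
    fun x hx => mem_iUnion.2 ⟨⟨x, hx⟩, (h ⟨x, hx⟩).mem⟩
  have hU : ⋃ i ∈ I, U i = YStar D := by
    refine Subset.antisymm (iUnion₂_subset fun i _ => (h i).subset) fun y hy => ?_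
    have := hI (subset_closure hy)
    simp only [mem_iUnion, exists_prop] at this ⊢
    obtain ⟨i, hi, hyi⟩ := this
    exact ⟨i, hi, (h i).inter_subset ⟨hyi, hy⟩⟩
  have hconn := hD.isConnected_YStar
  rw [← hU]
  refine isPoincare_biUnion I U ?_ (fun i => (h i).isOpen) (fun i => ?_) (fun i => (h i).isPoincare)
    (fun i => ?_) (by rw [hU]; exact hconn.isPreconnected)
  · obtain ⟨y, hy⟩ := hconn.nonempty
    rw [← hU] at hy
    simp only [mem_iUnion, exists_prop] at hy
    obtain ⟨i, hi, -⟩ := hy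
    exact ⟨i, hi⟩
  · exact (measure_mono (h i).subset).trans_lt (isBounded_YStar D).measure_lt_top
  · obtain ⟨y, hy1, hy2⟩ := mem_closure_iff.1 i.2 _ (h i).isOpen_nhd (h i).mem
    exact ⟨y, (h i).inter_subset ⟨hy1, hy2⟩⟩

/-! ### The Poincaré–Wirtinger inequality for functions of mean zero -/

theorem Lp_norm_sq {α F : Type*} [MeasurableSpace α] {μ : Measure α} [NormedAddCommGroup F]
    (f : Lp F 2 μ) : ‖f‖ ^ 2 = ∫ x, ‖f x‖ ^ 2 ∂μ := by
  have h0 : 0 ≤ ∫ x, ‖f x‖ ^ 2 ∂μ := integral_nonneg fun x => sq_nonneg _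
  rw [Lp.norm_def, (Lp.memLp f).eLpNorm_eq_integral_rpow_norm (by norm_num) (by norm_num),
    ENNReal.toReal_ofReal (by positivity)]
  simp only [ENNReal.toReal_ofNat, Real.rpow_ofNat]
  rw [← Real.rpow_ofNat, ← Real.rpow_mul h0]
  norm_num

/-- A function of mean zero is orthogonal to the constants: Pythagoras. -/
theorem integral_norm_sq_le_of_integral_eq_zero {α : Type*} [MeasurableSpace α] {μ : Measure α}
    [IsFiniteMeasure μ] {v : α → ℂ} (hv : MemLp v 2 μ) (h0 : ∫ x, v x ∂μ = 0) (c : ℂ) :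
    ∫ x, ‖v x‖ ^ 2 ∂μ ≤ ∫ x, ‖v x - c‖ ^ 2 ∂μ := by
  have hi : Integrable v μ := hv.integrable (by norm_num)
  have e : ∀ x, ‖v x - c‖ ^ 2 = ‖c‖ ^ 2 - 2 * inner ℝ c (v x) + ‖v x‖ ^ 2 := fun x => by
    rw [norm_sub_rev, norm_sub_sq_real]
  simp only [e]
  have i1 : Integrable (fun _ : α => ‖c‖ ^ 2) μ := integrable_const _
  have i2 : Integrable (fun x => 2 * inner ℝ c (v x)) μ := (hi.const_inner c).const_mul 2
  have i3 : Integrable (fun x => ‖c‖ ^ 2 - 2 * inner ℝ c (v x)) μ := i1.sub i2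
  rw [integral_add i3 hv.norm.integrable_sq, integral_sub i1 i2, integral_const_mul,
    integral_inner hi c, h0, inner_zero_right]
  have : 0 ≤ ∫ _ : α, ‖c‖ ^ 2 ∂μ := integral_nonneg fun _ => sq_nonneg _
  linarith

/-- The Poincaré–Wirtinger inequality on `Y*`. -/
theorem exists_norm_toL2_le {D : Set Plane} (hD : IsInclusion D) :
    ∃ C : ℝ, 0 ≤ C ∧ ∀ v ∈ H1PerZero D, ‖toL2 v‖ ^ 2 ≤ C * ‖wgrad v‖ ^ 2 := by
  obtain ⟨C, hC0, hC⟩ := (isPoincare_YStar hD).exists_nonneg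
  have : IsFiniteMeasure (volume.restrict (YStar D)) :=
    ⟨by simpa using (isBounded_YStar D).measure_lt_top⟩
  refine ⟨C, hC0, fun v hv => ?_⟩
  obtain ⟨c, hc⟩ := hC (toL2 v) (wgrad v) (Lp.memLp _) (Lp.memLp _) hv.1
  rw [Lp_norm_sq, Lp_norm_sq]
  exact (integral_norm_sq_le_of_integral_eq_zero (Lp.memLp _) hv.2.2 c).trans hc

/-- The arguments swap because `inner` is conjugate linear in its first slot. -/
theorem dotConj_eq_inner (a b : CVec) : dotConj a b = inner ℂ b a := by
  simp [dotConj, PiLp.inner_apply]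

/-! ### The equation for the correctors in `L²(Ω; L²)` -/

/-- `(v, ∇v) ↦ v` on a subspace of pairs. -/
def valL {s : Set Plane} (X : Submodule ℂ (L2Pair s)) : X →L[ℂ] Lp ℂ 2 (volume.restrict s) :=
  (WithLp.fstL 2 ℂ _ _).comp X.subtypeL

/-- `(v, ∇v) ↦ ∇v` on a subspace of pairs. -/
def gradL {s : Set Plane} (X : Submodule ℂ (L2Pair s)) : X →L[ℂ] Lp CVec 2 (volume.restrict s) :=
  (WithLp.sndL 2 ℂ _ _).comp X.subtypeL

/-- `v₂ ∈ L²(Ω; X)` as an element of `L²(Ω; L²(s))`. -/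
def bval {s : Set Plane} (X : Submodule ℂ (L2Pair s)) (Ω : Set Plane) :
    L2Bochner Ω X →L[ℂ] Lp (Lp ℂ 2 (volume.restrict s)) 2 (volume.restrict Ω) :=
  (valL X).compLpL 2 (volume.restrict Ω)

/-- `∇_y v₂ ∈ L²(Ω; L²(s))` for `v₂ ∈ L²(Ω; X)`. -/
def bgrad {s : Set Plane} (X : Submodule ℂ (L2Pair s)) (Ω : Set Plane) :
    L2Bochner Ω X →L[ℂ] Lp (Lp CVec 2 (volume.restrict s)) 2 (volume.restrict Ω) :=
  (gradL X).compLpL 2 (volume.restrict Ω)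

theorem coeFn_bval {s : Set Plane} (X : Submodule ℂ (L2Pair s)) (Ω : Set Plane)
    (v : L2Bochner Ω X) : bval X Ω v =ᵐ[volume.restrict Ω] fun x => toL2 (v x).1 :=
  ContinuousLinearMap.coeFn_compLpL (valL X) v

theorem coeFn_bgrad {s : Set Plane} (X : Submodule ℂ (L2Pair s)) (Ω : Set Plane)
    (v : L2Bochner Ω X) : bgrad X Ω v =ᵐ[volume.restrict Ω] fun x => wgrad (v x).1 :=
  ContinuousLinearMap.coeFn_compLpL (gradL X) v

/-- Restriction of `L²(G)` functions to `Ω`. -/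
def restrictLp {F : Type} [NormedAddCommGroup F] {Ω G : Set Plane} (h : Ω ⊆ G)
    (f : Lp F 2 (volume.restrict G)) : Lp F 2 (volume.restrict Ω) :=
  ((Lp.memLp f).mono_measure (Measure.restrict_mono h le_rfl)).toLp f

theorem coeFn_restrictLp {F : Type} [NormedAddCommGroup F] {Ω G : Set Plane} (h : Ω ⊆ G)
    (f : Lp F 2 (volume.restrict G)) : restrictLp h f =ᵐ[volume.restrict Ω] f :=
  MemLp.coeFn_toLp _

theorem norm_restrictLp_le {F : Type} [NormedAddCommGroup F] {Ω G : Set Plane} (h : Ω ⊆ G)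
    (f : Lp F 2 (volume.restrict G)) : ‖restrictLp h f‖ ≤ ‖f‖ := by
  rw [restrictLp, Lp.norm_toLp, Lp.norm_def]
  exact ENNReal.toReal_mono (Lp.eLpNorm_ne_top f)
    (eLpNorm_mono_measure _ (Measure.restrict_mono h le_rfl))

/-- The embedding of constants into `L²(s)`. -/
def constEmb (F : Type) [NormedAddCommGroup F] [NormedSpace ℂ F] (s : Set Plane)
    [IsFiniteMeasure (volume.restrict s)] : F →L[ℂ] Lp F 2 (volume.restrict s) :=
  Lp.constL 2 (volume.restrict s) ℂ

theorem coeFn_constEmb {F : Type} [NormedAddCommGroup F] [NormedSpace ℂ F] {s : Set Plane}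
    [IsFiniteMeasure (volume.restrict s)] (a : F) :
    constEmb F s a =ᵐ[volume.restrict s] fun _ => a := by
  rw [constEmb, Lp.constL_apply]
  exact Lp.coeFn_const 2 (volume.restrict s) a

/-- Functions on `Ω` as functions on `Ω × s` that do not depend on the second variable. -/
def bconst (F : Type) [NormedAddCommGroup F] [NormedSpace ℂ F] (s Ω : Set Plane)
    [IsFiniteMeasure (volume.restrict s)] :
    Lp F 2 (volume.restrict Ω) →L[ℂ] Lp (Lp F 2 (volume.restrict s)) 2 (volume.restrict Ω) :=
  (constEmb F s).compLpL 2 (volume.restrict Ω)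

theorem coeFn_bconst (F : Type) [NormedAddCommGroup F] [NormedSpace ℂ F] (s Ω : Set Plane)
    [IsFiniteMeasure (volume.restrict s)] (f : Lp F 2 (volume.restrict Ω)) :
    bconst F s Ω f =ᵐ[volume.restrict Ω] fun x => constEmb F s (f x) :=
  ContinuousLinearMap.coeFn_compLpL (constEmb F s) f

theorem norm_bconst_le (F : Type) [NormedAddCommGroup F] [NormedSpace ℂ F] (s Ω : Set Plane)
    [IsFiniteMeasure (volume.restrict s)] (f : Lp F 2 (volume.restrict Ω)) :
    ‖bconst F s Ω f‖ ≤ ‖constEmb F s‖ * ‖f‖ :=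
  ContinuousLinearMap.norm_compLp_le (constEmb F s) f

theorem Lp_norm_sq_eq_integral {α F : Type*} [MeasurableSpace α] {μ : Measure α}
    [NormedAddCommGroup F] {f : Lp F 2 μ} {g : α → F} (h : f =ᵐ[μ] g) :
    ‖f‖ ^ 2 = ∫ x, ‖g x‖ ^ 2 ∂μ := by
  rw [Lp_norm_sq]
  refine integral_congr_ae ?_
  filter_upwards [h] with x hx
  rw [hx]

theorem inner_add_eq_integral {α H : Type*} [MeasurableSpace α] {μ : Measure α}
    [NormedAddCommGroup H] [InnerProductSpace ℂ H] {P A U : Lp H 2 μ} {p a u : α → H}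
    (hP : P =ᵐ[μ] p) (hA : A =ᵐ[μ] a) (hU : U =ᵐ[μ] u) :
    inner ℂ P (A + U) = ∫ x, inner ℂ (p x) (a x + u x) ∂μ := by
  rw [L2.inner_def]
  refine integral_congr_ae ?_
  filter_upwards [hP, hA, hU, Lp.coeFn_add A U] with x h1 h2 h3 h4
  rw [h4, Pi.add_apply, h1, h2, h3]

theorem inner_eq_integral {α H : Type*} [MeasurableSpace α] {μ : Measure α}
    [NormedAddCommGroup H] [InnerProductSpace ℂ H] {P U : Lp H 2 μ} {p u : α → H}
    (hP : P =ᵐ[μ] p) (hU : U =ᵐ[μ] u) :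
    inner ℂ P U = ∫ x, inner ℂ (p x) (u x) ∂μ := by
  rw [L2.inner_def]
  refine integral_congr_ae ?_
  filter_upwards [hP, hU] with x h1 h2
  rw [h1, h2]

theorem integral_dotConj_const_add {s : Set Plane} [IsFiniteMeasure (volume.restrict s)]
    (a : CVec) (P Q : Lp CVec 2 (volume.restrict s)) :
    ∫ y in s, dotConj (a + P y) (Q y) = inner ℂ Q (constEmb _ s a + P) := by
  rw [inner_add_eq_integral (ae_eq_refl _) (coeFn_constEmb a) (ae_eq_refl _)]
  simp only [dotConj_eq_inner]

theorem integral_dotConj {s : Set Plane} (P Q : Lp CVec 2 (volume.restrict s)) :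
    ∫ y in s, dotConj (P y) (Q y) = inner ℂ Q P := by
  rw [L2.inner_def]
  simp only [dotConj_eq_inner]

theorem integral_const_add_mul_conj {s : Set Plane} [IsFiniteMeasure (volume.restrict s)]
    (a : ℂ) (P Q : Lp ℂ 2 (volume.restrict s)) :
    ∫ y in s, (a + P y) * conj (Q y) = inner ℂ Q (constEmb _ s a + P) := by
  rw [inner_add_eq_integral (ae_eq_refl _) (coeFn_constEmb a) (ae_eq_refl _)]
  simp only [RCLike.inner_apply]

theorem coeFn_bconst_restrictLp (F : Type) [NormedAddCommGroup F] [NormedSpace ℂ F]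
    (s : Set Plane) {Ω G : Set Plane} [IsFiniteMeasure (volume.restrict s)] (h : Ω ⊆ G)
    (f : Lp F 2 (volume.restrict G)) :
    bconst F s Ω (restrictLp h f) =ᵐ[volume.restrict Ω]
      fun x => constEmb F s (f x) := by
  filter_upwards [coeFn_bconst F s Ω (restrictLp h f), coeFn_restrictLp h f] with x h1 h2
  rw [h1, h2]

section Form

variable {D Ω G : Set Plane}

/-- The inner integral is an inner product in `L²(Y*)` for each `x`, and the outer one then an inner
product in `L²(Ω; L²(Y*))`; joint measurability on `Ω × Y*` never enters. -/
theorem integral_macro_term [IsFiniteMeasure (volume.restrict (YStar D))] (h : Ω ⊆ G)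
    (u : H1 G) (u₁ ψ₁ : L2Bochner Ω (H1PerZero D)) (c : ℂ) :
    ∫ x in Ω, ∫ y in YStar D, c * dotConj (wgrad u.1 x + gradY1 u₁ x y)
        (wgrad (0 : H1 G).1 x + gradY1 ψ₁ x y) =
      c * inner ℂ (bgrad (H1PerZero D) Ω ψ₁)
        (bconst CVec (YStar D) Ω (restrictLp h (wgrad u.1)) + bgrad (H1PerZero D) Ω u₁) := by
  rw [inner_add_eq_integral (coeFn_bgrad (H1PerZero D) Ω ψ₁)
    (coeFn_bconst_restrictLp CVec (YStar D) h (wgrad u.1)) (coeFn_bgrad (H1PerZero D) Ω u₁),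
    ← integral_const_mul]
  refine integral_congr_ae ?_
  have h0 : wgrad (0 : H1 G).1 =ᵐ[volume.restrict Ω] (0 : Plane → CVec) :=
    ae_mono (Measure.restrict_mono h le_rfl) (Lp.coeFn_zero CVec 2 (volume.restrict G))
  filter_upwards [h0] with x k0
  have k1 : ∀ z, wgrad (0 : H1 G).1 x + z = z := fun z => by rw [k0]; exact zero_add z
  simp_rw [k1]
  exact (integral_const_mul c _).trans (congrArg (c * ·)
    (integral_dotConj_const_add (wgrad u.1 x) (wgrad (u₁ x).1) (wgrad (ψ₁ x).1)))

theorem integral_micro_term (u₂ ψ₂ : L2Bochner Ω (H10 D)) (c : ℂ) :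
    ∫ x in Ω, ∫ y in D, c * dotConj (gradY2 u₂ x y) (gradY2 ψ₂ x y) =
      c * inner ℂ (bgrad (H10 D) Ω ψ₂) (bgrad (H10 D) Ω u₂) := by
  rw [inner_eq_integral (coeFn_bgrad (H10 D) Ω ψ₂) (coeFn_bgrad (H10 D) Ω u₂), ← integral_const_mul]
  refine integral_congr_ae (Eventually.of_forall fun x => ?_)
  exact (integral_const_mul c _).trans
    (congrArg (c * ·) (integral_dotConj (wgrad (u₂ x).1) (wgrad (ψ₂ x).1)))

theorem setIntegral_indicator_of_subset {s t : Set Plane} (hs : MeasurableSet s) (hst : s ⊆ t)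
    (f : Plane → ℂ) : ∫ x in t, s.indicator f x = ∫ x in s, f x := by
  rw [integral_indicator hs, Measure.restrict_restrict hs, inter_eq_self_of_subset_left hst]

/-- With `ψ = 0` the conjugated factor vanishes off `Ω × D`, which cuts the domain `G × Y` down to
`Ω × D`. -/
theorem integral_mass_term [IsFiniteMeasure (volume.restrict D)] (hDm : MeasurableSet D)
    (hDc : D ⊆ cell) (hΩ : MeasurableSet Ω) (h : Ω ⊆ G) (u : H1 G) (u₂ ψ₂ : L2Bochner Ω (H10 D)) :
    ∫ x in G, ∫ y in cell, (toL2 u.1 x + chiD u₂ x y) *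
        conj (toL2 (0 : H1 G).1 x + chiD ψ₂ x y) =
      inner ℂ (bval (H10 D) Ω ψ₂) (bconst ℂ D Ω (restrictLp h (toL2 u.1)) + bval (H10 D) Ω u₂) := by
  have h0 : toL2 (0 : H1 G).1 =ᵐ[volume.restrict G] (0 : Plane → ℂ) :=
    Lp.coeFn_zero ℂ 2 (volume.restrict G)
  have e : ∫ x in G, ∫ y in cell, (toL2 u.1 x + chiD u₂ x y) *
        conj (toL2 (0 : H1 G).1 x + chiD ψ₂ x y) =
      ∫ x in G, Ω.indicator (fun x => ∫ y in D, (toL2 u.1 x + toL2 (u₂ x).1 y) *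
        conj (toL2 (ψ₂ x).1 y)) x := by
    refine integral_congr_ae ?_
    filter_upwards [h0] with x hx
    have k1 : ∀ z, toL2 (0 : H1 G).1 x + z = z := fun z => by rw [hx]; exact zero_add z
    simp_rw [k1]
    by_cases hxΩ : x ∈ Ω
    · rw [indicator_of_mem hxΩ]
      refine Eq.trans ?_ (setIntegral_indicator_of_subset hDm hDc _)
      refine integral_congr_ae (Eventually.of_forall fun y => ?_)
      by_cases hy : y ∈ D
      · simp only [chiD, indicator_of_mem hxΩ, indicator_of_mem hy]
      · simp only [chiD, indicator_of_mem hxΩ, indicator_of_notMem hy, map_zero, mul_zero]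
    · rw [indicator_of_notMem hxΩ]
      simp only [chiD, indicator_of_notMem hxΩ, map_zero, mul_zero, integral_zero]
  refine e.trans ((setIntegral_indicator_of_subset hΩ h _).trans (Eq.trans ?_
    (inner_add_eq_integral (coeFn_bval (H10 D) Ω ψ₂)
      (coeFn_bconst_restrictLp ℂ D h (toL2 u.1)) (coeFn_bval (H10 D) Ω u₂)).symm))
  refine integral_congr_ae (Eventually.of_forall fun x => ?_)
  exact integral_const_add_mul_conj (toL2 u.1 x) (toL2 (u₂ x).1) (toL2 (ψ₂ x).1)

theorem twoScaleForm_zero [IsFiniteMeasure (volume.restrict D)]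
    [IsFiniteMeasure (volume.restrict (YStar D))] (hDm : MeasurableSet D) (hDc : D ⊆ cell)
    (hΩ : MeasurableSet Ω) (h : Ω ⊆ G) (εi : ℂ) (εe k : ℝ) (u : H1 G) (tu : Lp ℂ 2 (bdry G))
    (u₁ ψ₁ : L2Bochner Ω (H1PerZero D)) (u₂ ψ₂ : L2Bochner Ω (H10 D)) :
    twoScaleForm εi εe k u tu u₁ u₂ 0 0 ψ₁ ψ₂ =
      (εe : ℂ)⁻¹ * inner ℂ (bgrad (H1PerZero D) Ω ψ₁)
        (bconst CVec (YStar D) Ω (restrictLp h (wgrad u.1)) + bgrad (H1PerZero D) Ω u₁)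
      + εi⁻¹ * inner ℂ (bgrad (H10 D) Ω ψ₂) (bgrad (H10 D) Ω u₂)
      - (k : ℂ) ^ 2 *
        inner ℂ (bval (H10 D) Ω ψ₂) (bconst ℂ D Ω (restrictLp h (toL2 u.1)) + bval (H10 D) Ω u₂) := by
  have e4 : ∫ x in G \ closure Ω, dotConj (wgrad u.1 x) (wgrad (0 : H1 G).1 x) = 0 := by
    have h0 : wgrad (0 : H1 G).1 =ᵐ[volume.restrict (G \ closure Ω)] (0 : Plane → CVec) :=
      ae_mono (Measure.restrict_mono sdiff_subset le_rfl) (Lp.coeFn_zero CVec 2 (volume.restrict G))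
    rw [integral_congr_ae (g := fun _ => 0), integral_zero]
    filter_upwards [h0] with x hx
    rw [hx]
    simp [dotConj]
  have e5 : ∫ x, tu x * conj ((0 : Lp ℂ 2 (bdry G)) x) ∂(bdry G) = 0 := by
    rw [integral_congr_ae (g := fun _ => 0), integral_zero]
    filter_upwards [Lp.coeFn_zero ℂ 2 (bdry G)] with x hx
    rw [hx]
    simp
  have e1 := integral_macro_term h u u₁ ψ₁ (εe : ℂ)⁻¹
  have e2 := integral_micro_term u₂ ψ₂ εi⁻¹
  have e3 := integral_mass_term hDm hDc hΩ h u u₂ ψ₂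
  unfold twoScaleForm
  linear_combination e1 + e2 - (k : ℂ) ^ 2 * e3 + e4 - Complex.I * (k : ℂ) * e5

theorem isTrace_zero : IsTrace G 0 0 := by
  refine subset_closure ⟨0, contDiff_const, ?_, ?_⟩
  · exact Lp.coeFn_zero ℂ 2 (volume.restrict G)
  · exact Lp.coeFn_zero ℂ 2 (bdry G)

end Form

/-! ### Energy estimates -/

/-- The hypothesis says `‖P‖² = -⟨P, A⟩`; apply Cauchy–Schwarz and divide by `‖P‖`. -/
theorem norm_le_of_inner_add_eq_zero {H : Type*} [NormedAddCommGroup H] [InnerProductSpace ℂ H]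
    {P A : H} (h : inner ℂ P (A + P) = 0) : ‖P‖ ≤ ‖A‖ := by
  rw [inner_add_right, inner_self_eq_norm_sq_to_K] at h
  have h1 : ‖P‖ ^ 2 = ‖inner ℂ P A‖ := by
    rw [eq_neg_of_add_eq_zero_left h]
    simp
  have h2 := norm_inner_le_norm (𝕜 := ℂ) P A
  rcases (norm_nonneg P).eq_or_lt with h0 | h0
  · rw [← h0]
    positivity
  · nlinarith

/-- The energy estimate for a dissipative Helmholtz problem. -/
theorem energy_le_of_dissipative {H H' : Type*} [NormedAddCommGroup H] [InnerProductSpace ℂ H]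
    [NormedAddCommGroup H'] [InnerProductSpace ℂ H'] {e : ℂ} (he : e.im < 0) {k : ℝ} (hk : 0 < k)
    {P : H} {W A : H'}
    (h : e * inner ℂ P P - (k : ℂ) ^ 2 * inner ℂ W (A + W) = 0) :
    ‖P‖ ^ 2 + k ^ 2 * ‖W‖ ^ 2 ≤
      (|e.re| / (-e.im) + 1 + (-e.im)⁻¹) * (|e.re| / (-e.im) + 1) * (k ^ 2 * ‖A‖ ^ 2) := by
  set i := -e.im with hi
  have hi0 : 0 < i := by linarith
  set B := |e.re| / i + 1 with hB
  have hB0 : 0 < B := by positivity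
  set c := inner ℂ W A
  have hc : ‖c‖ ≤ ‖W‖ * ‖A‖ := norm_inner_le_norm (𝕜 := ℂ) W A
  rw [inner_add_right, inner_self_eq_norm_sq_to_K, inner_self_eq_norm_sq_to_K] at h
  have him := congrArg Complex.im h
  have hre := congrArg Complex.re h
  have e1 : ((‖P‖ : ℂ) ^ 2) = ((‖P‖ ^ 2 : ℝ) : ℂ) := by push_cast; rfl
  have e2 : ((‖W‖ : ℂ) ^ 2) = ((‖W‖ ^ 2 : ℝ) : ℂ) := by push_cast; rfl
  have e3 : ((k : ℂ) ^ 2) = ((k ^ 2 : ℝ) : ℂ) := by push_cast; rfl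
  simp only [Complex.coe_algebraMap] at him hre
  rw [e1, e2, e3] at him hre
  simp only [Complex.sub_im, Complex.sub_re, Complex.im_mul_ofReal, Complex.re_mul_ofReal,
    Complex.im_ofReal_mul, Complex.re_ofReal_mul, Complex.add_im, Complex.add_re,
    Complex.ofReal_im, Complex.ofReal_re, Complex.zero_im, Complex.zero_re, add_zero] at him hre
  have hcim : -c.im ≤ ‖W‖ * ‖A‖ := (neg_le_abs _).trans ((Complex.abs_im_le_norm c).trans hc)
  have hcre : -c.re ≤ ‖W‖ * ‖A‖ := (neg_le_abs _).trans ((Complex.abs_re_le_norm c).trans hc)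
  have hk2 : 0 < k ^ 2 := by positivity
  -- Imaginary part: `⟨W, W⟩` is real, so only the dissipation and the source `c` remain.
  have hP : i * ‖P‖ ^ 2 ≤ k ^ 2 * (‖W‖ * ‖A‖) := by nlinarith
  have hP' : ‖P‖ ^ 2 ≤ i⁻¹ * (k ^ 2 * (‖W‖ * ‖A‖)) := by
    rw [inv_mul_eq_div, le_div_iff₀ hi0]
    linarith
  -- Real part: `‖W‖²` is governed by the source and by the gradient bound just found.
  have hW : k ^ 2 * ‖W‖ ^ 2 ≤ k ^ 2 * (B * (‖W‖ * ‖A‖)) := by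
    have l1 : e.re * ‖P‖ ^ 2 ≤ |e.re| * (i⁻¹ * (k ^ 2 * (‖W‖ * ‖A‖))) :=
      (mul_le_mul_of_nonneg_right (le_abs_self _) (sq_nonneg _)).trans
        (mul_le_mul_of_nonneg_left hP' (abs_nonneg _))
    have l2 := mul_le_mul_of_nonneg_left hcre hk2.le
    calc k ^ 2 * ‖W‖ ^ 2 = e.re * ‖P‖ ^ 2 + k ^ 2 * -c.re := by linarith
      _ ≤ |e.re| * (i⁻¹ * (k ^ 2 * (‖W‖ * ‖A‖))) + k ^ 2 * (‖W‖ * ‖A‖) := add_le_add l1 l2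
      _ = k ^ 2 * (B * (‖W‖ * ‖A‖)) := by rw [hB]; ring
  have hWA : ‖W‖ ≤ B * ‖A‖ := by
    have h3 := le_of_mul_le_mul_left hW hk2
    rcases (norm_nonneg W).eq_or_lt with h0 | h0
    · rw [← h0]
      positivity
    · nlinarith
  have hWAA : ‖W‖ * ‖A‖ ≤ B * ‖A‖ ^ 2 := by nlinarith [norm_nonneg A]
  calc ‖P‖ ^ 2 + k ^ 2 * ‖W‖ ^ 2
      ≤ i⁻¹ * (k ^ 2 * (‖W‖ * ‖A‖)) + k ^ 2 * (B * (‖W‖ * ‖A‖)) := add_le_add hP' hW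
    _ = (B + i⁻¹) * k ^ 2 * (‖W‖ * ‖A‖) := by ring
    _ ≤ (B + i⁻¹) * k ^ 2 * (B * ‖A‖ ^ 2) := by gcongr
    _ = _ := by ring

theorem le_sqrt_mul_of_sq_eq {a b c C : ℝ} (hC : 0 ≤ C) (hc : 0 ≤ c) (h : a ^ 2 = b ^ 2 + c ^ 2)
    (hb : b ^ 2 ≤ C * c ^ 2) : a ≤ √(C + 1) * c := by
  refine le_of_abs_le (abs_le_of_sq_le_sq ?_ (by positivity))
  rw [mul_pow, Real.sq_sqrt (by positivity), h]
  linarith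

theorem sqrt_le_of_le_mul_sq {x a b c B K k : ℝ} (hB : 0 ≤ B) (ha : 0 ≤ a) (hab : a ≤ K * b)
    (hx : x ≤ B * (k ^ 2 * a ^ 2)) :
    √x ≤ (√(B * K ^ 2) + 1) * √(c ^ 2 + k ^ 2 * b ^ 2) := by
  have h : x ≤ (B * K ^ 2) * (c ^ 2 + k ^ 2 * b ^ 2) := by
    calc x ≤ B * (k ^ 2 * a ^ 2) := hx
      _ ≤ B * (k ^ 2 * (K * b) ^ 2) := by gcongr
      _ = (B * K ^ 2) * (k ^ 2 * b ^ 2) := by ring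
      _ ≤ _ := by
        gcongr
        linarith [sq_nonneg c]
  refine (Real.sqrt_le_sqrt h).trans ?_
  rw [Real.sqrt_mul (by positivity)]
  gcongr
  linarith

/-- The Poincaré–Wirtinger inequality is applied for almost every `x`; adding the gradient to the
`H¹` norm turns `C` into `C + 1`. -/
theorem norm_le_norm_bgrad {D : Set Plane} {C : ℝ} (hC0 : 0 ≤ C)
    (hC : ∀ v ∈ H1PerZero D, ‖toL2 v‖ ^ 2 ≤ C * ‖wgrad v‖ ^ 2) {Ω : Set Plane}
    (u₁ : L2Bochner Ω (H1PerZero D)) : ‖u₁‖ ≤ √(C + 1) * ‖bgrad (H1PerZero D) Ω u₁‖ := by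
  refine Lp.norm_le_mul_norm_of_ae_le_mul ?_
  filter_upwards [coeFn_bgrad (H1PerZero D) Ω u₁] with x hx
  have hn : ‖bgrad (H1PerZero D) Ω u₁ x‖ = ‖wgrad (u₁ x).1‖ := congrArg norm hx
  have h1 : ‖u₁ x‖ ^ 2 = ‖toL2 (u₁ x).1‖ ^ 2 + ‖wgrad (u₁ x).1‖ ^ 2 :=
    WithLp.prod_norm_sq_eq_of_L2 (u₁ x).1
  have h2 : ‖toL2 (u₁ x).1‖ ^ 2 ≤ C * ‖wgrad (u₁ x).1‖ ^ 2 := hC (u₁ x).1 (u₁ x).2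
  exact (le_sqrt_mul_of_sq_eq hC0 (norm_nonneg _) h1 h2).trans_eq
    (congrArg (√(C + 1) * ·) hn.symm)

theorem normL2H1k_eq {Ω D : Set Plane} (k : ℝ) (v₂ : L2Bochner Ω (H10 D)) :
    normL2H1k k v₂ = √(‖bgrad (H10 D) Ω v₂‖ ^ 2 + k ^ 2 * ‖bval (H10 D) Ω v₂‖ ^ 2) := by
  have h1 : ‖bgrad (H10 D) Ω v₂‖ ^ 2 = ∫ x in Ω, ‖wgrad (v₂ x).1‖ ^ 2 :=
    Lp_norm_sq_eq_integral (coeFn_bgrad (H10 D) Ω v₂)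
  have h2 : ‖bval (H10 D) Ω v₂‖ ^ 2 = ∫ x in Ω, ‖toL2 (v₂ x).1‖ ^ 2 :=
    Lp_norm_sq_eq_integral (coeFn_bval (H10 D) Ω v₂)
  exact congrArg Real.sqrt (congrArg₂ (· + ·) h1.symm (congrArg (k ^ 2 * ·) h2.symm))

end TwoScale

end

/-! ### The corrector estimates -/

open TwoScale
theorem proposition3p5
    (D : Set Plane) (hD : IsInclusion D)
    (εi : ℂ) (hεi_im : 0 < εi.im) (hεi_re : 0 < εi.re)
    (εe : ℝ) (hεe : 0 < εe) (k₀ : ℝ) (hk₀ : 0 < k₀) :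
    ∃ C₁ C₂ : ℝ, 0 < C₁ ∧ 0 < C₂ ∧
      ∀ k : ℝ, k₀ ≤ k →
      ∀ Ω G : Set Plane, IsC2Domain Ω → IsConvexPolygon G → closure Ω ⊆ G →
      ∀ (g : Lp ℂ 2 (bdry G)) (u : H1 G)
        (u₁ : L2Bochner Ω (H1PerZero D)) (u₂ : L2Bochner Ω (H10 D)),
        IsTwoScaleSolution εi εe k g u u₁ u₂ →
          ‖u₁‖ ≤ C₁ * ‖wgrad u.1‖ ∧ normL2H1k k u₂ ≤ C₂ * normH1k k u := by
  obtain ⟨C, hC0, hC⟩ := exists_norm_toL2_le hD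
  have hfD : IsFiniteMeasure (volume.restrict D) :=
    ⟨by simpa using hD.isC2Domain.isBounded.measure_lt_top⟩
  have hfY : IsFiniteMeasure (volume.restrict (YStar D)) :=
    ⟨by simpa using (isBounded_YStar D).measure_lt_top⟩
  have hDm : MeasurableSet D := hD.isC2Domain.isOpen.measurableSet
  have hDc : D ⊆ cell := fun y hy j =>
    Ioo_subset_Ico_self (hD.closure_subset (subset_closure hy) j)
  set K₁ := ‖constEmb CVec (YStar D)‖
  set K₂ := ‖constEmb ℂ D‖
  have hεi0 : εi ≠ 0 := fun h => by simp [h] at hεi_re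
  -- Inversion flips the sign of the imaginary part; this is the dissipation that the estimate of
  -- `u₂` rests on.
  have he : (εi⁻¹).im < 0 := by
    rw [Complex.inv_im]
    exact div_neg_of_neg_of_pos (by linarith) (Complex.normSq_pos.2 hεi0)
  set B := (|(εi⁻¹).re| / (-(εi⁻¹).im) + 1 + (-(εi⁻¹).im)⁻¹) *
    (|(εi⁻¹).re| / (-(εi⁻¹).im) + 1)
  have hB0 : 0 ≤ B := by
    have : 0 < -(εi⁻¹).im := by linarith
    positivity
  -- The added `1` only makes the constants strictly positive. `K₁` and `K₂` are the norms of the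
  -- embeddings of constants into `L²(Y*)` and `L²(D)`.
  refine ⟨√(C + 1) * K₁ + 1, √(B * K₂ ^ 2) + 1, by positivity, by positivity, ?_⟩
  intro k hk Ω G hΩ _ hΩG g u u₁ u₂ hsol
  have hk0 : 0 < k := hk₀.trans_le hk
  have hsub : Ω ⊆ G := subset_closure.trans hΩG
  obtain ⟨tu, -, heq⟩ := hsol
  have key : ∀ (ψ₁ : L2Bochner Ω (H1PerZero D)) (ψ₂ : L2Bochner Ω (H10 D)),
      twoScaleForm εi εe k u tu u₁ u₂ 0 0 ψ₁ ψ₂ = 0 := fun ψ₁ ψ₂ => by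
    refine (heq 0 0 isTrace_zero ψ₁ ψ₂).trans ?_
    rw [integral_congr_ae (g := fun _ => 0), integral_zero]
    filter_upwards [Lp.coeFn_zero ℂ 2 (bdry G)] with x hx
    rw [hx]
    simp
  simp only [twoScaleForm_zero hDm hDc hΩ.isOpen.measurableSet hsub] at key
  constructor
  -- Testing with `u₁` itself isolates the cell problem on `Y*`.
  · have h := key u₁ 0
    simp only [map_zero, inner_zero_left, mul_zero, add_zero, sub_zero] at h
    have h1 := norm_le_of_inner_add_eq_zero ((mul_eq_zero.1 h).resolve_left
      (inv_ne_zero (Complex.ofReal_ne_zero.2 hεe.ne')))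
    have h2 : ‖bconst CVec (YStar D) Ω (restrictLp hsub (wgrad u.1))‖ ≤ K₁ * ‖wgrad u.1‖ :=
      (norm_bconst_le CVec (YStar D) Ω _).trans
        (mul_le_mul_of_nonneg_left (norm_restrictLp_le hsub _) (norm_nonneg _))
    calc ‖u₁‖ ≤ √(C + 1) * ‖bgrad (H1PerZero D) Ω u₁‖ := norm_le_norm_bgrad hC0 hC u₁
      _ ≤ √(C + 1) * (K₁ * ‖wgrad u.1‖) := by gcongr; exact h1.trans h2
      _ ≤ (√(C + 1) * K₁ + 1) * ‖wgrad u.1‖ := by linarith [norm_nonneg (wgrad u.1)]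
  -- Testing with `u₂` itself isolates the dissipative Helmholtz problem on `D`.
  · have h := key 0 u₂
    simp only [map_zero, inner_zero_left, mul_zero, zero_add] at h
    have h1 := energy_le_of_dissipative he hk0 h
    have h2 : ‖bconst ℂ D Ω (restrictLp hsub (toL2 u.1))‖ ≤ K₂ * ‖toL2 u.1‖ :=
      (norm_bconst_le ℂ D Ω _).trans
        (mul_le_mul_of_nonneg_left (norm_restrictLp_le hsub _) (norm_nonneg _))
    exact (normL2H1k_eq k u₂).trans_le
      (sqrt_le_of_le_mul_sq (c := ‖wgrad u.1‖) hB0 (norm_nonneg _) h2 h1)
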